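/- All graphs are finite and simple. A multiset $\mathscr{P}$ of paths in a graph $G$ is a \emph{$2$-rainbow separating path system} of $G$ if its elements can be colored with $2$ colors so that for every two distinct edges $e_1,e_2$ of $G$ there exist paths $P_1,P_2\in\mathscr{P}$ of distinct colors such that $P_1$ contains $e_1$ but not $e_2$, and $P_2$ contains $e_2$ but not $e_1$. Let $c_2(G)$ denote the smallest cardinality (counted with multiplicity) of a $2$-rainbow separating path system of $G$. Theorem. Let $T$ be a tree with $n\ge 2$ vertices. Then \[ c_2(T)\le \frac{4(n-1)}{3}. \] -/

import Mathlib

/-- The subgraph `H` of `G` is a path of `G`, that is, the subgraph traced by a walk without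
repeated vertices. -/
def SimpleGraph.Subgraph.IsPathOf {V : Type*} {G : SimpleGraph V} (H : G.Subgraph) : Prop :=
  ∃ (u v : V) (p : G.Walk u v), p.IsPath ∧ p.toSubgraph = H

/-- `P` is a `k`-rainbow separating path system of `G`: a multiset of paths of `G` whose elements
can be coloured with `k` colours (different copies of the same path may get different colours)
so that any two distinct edges `e₁`, `e₂` are separated by two paths of distinct colours, one of
which contains `e₁` but not `e₂` and the other `e₂` but not `e₁`. The multiset `Q` below is `P`
together with such a colouring. -/
def SimpleGraph.IsRainbowSeparating {V : Type*} (G : SimpleGraph V) (k : ℕ)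
    (P : Multiset G.Subgraph) : Prop :=
  (∀ H ∈ P, H.IsPathOf) ∧
    ∃ Q : Multiset (G.Subgraph × Fin k), Q.map Prod.fst = P ∧
      ∀ e₁ ∈ G.edgeSet, ∀ e₂ ∈ G.edgeSet, e₁ ≠ e₂ →
        ∃ x ∈ Q, ∃ y ∈ Q, x.2 ≠ y.2 ∧
          (e₁ ∈ x.1.edgeSet ∧ e₂ ∉ x.1.edgeSet) ∧ (e₂ ∈ y.1.edgeSet ∧ e₁ ∉ y.1.edgeSet)

/-- The `k`-rainbow separation number `c_k(G)`: the smallest cardinality (with multiplicity) of a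
`k`-rainbow separating path system of `G`; it is `⊤` if there is no finite one. -/
noncomputable def SimpleGraph.rainbowSeparationNumber {V : Type*} (G : SimpleGraph V) (k : ℕ) :
    ℕ∞ :=
  ⨅ (P : Multiset G.Subgraph) (_ : G.IsRainbowSeparating k P), (P.card : ℕ∞)

/-! The proof is an induction over vertex sets `U` inducing subtrees, with a budget of 4(|U| - 1)/3
paths that separate and cover the edges inside `U`. Gluing drives it. Suppose a union `A` of
branches at `v` is cut off, and the edges inside `A ∪ {v}` have a separating system covering each
edge in both colours. Together with any covering system of the rest it separates everything: an edge
of the rest lies on a path of some colour, an edge of the piece lies on one of the other colour, and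
neither path meets the other edge set. So at most 4|A|/3 paths for the piece suffice
(`Branching.bounded`).

Such two-coloured pieces come from growth (`Growing`). At each leaf still to be extended, two paths
of distinct colours use the leaf edge, and one of them is redundant for covering in its colour. This
allows the one or two missing neighbours of the leaf to be added at the cost of one new path each.
Starting from an edge, a tree of maximum degree at most three gets one path more than it has
vertices; the same count holds with one vertex of degree four having two leaf neighbours. A piece `A
∪ {v}` then costs |A| + 2 paths, which fits as soon as |A| ≥ 6.

If some degree is at least four, `exists_extremal` gives `v` of degree at least four and a neighbour
`h` such that vertices other than `v` outside the branch through `h` have degree at most three.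
Three leaves at `v` form a star that costs four paths. Otherwise three non-leaf branches, or two
leaves and two non-leaf branches, contain at least six vertices. What remains is three branches
besides the one through `h`: with at least five vertices in total, the cut is made at `h` so that
`v` is removed as well; with four vertices they form a fork, which `CoverNum.fork` attaches with
five paths. If all degrees are at most three, growth handles |U| ≥ 7 directly and explicit systems
handle the small trees. -/

namespace RainbowTree

open SimpleGraph

universe u

/-! ### Two-coloured path systems on a set of edges, and gluing -/

section

variable {V : Type u}

/-- `A` is the edge set of a path of `T`. -/
def IsTrace (T : SimpleGraph V) (A : Set (Sym2 V)) : Prop :=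
  ∃ (u v : V) (p : T.Walk u v), p.IsPath ∧ A = {e | e ∈ p.edges}

theorem isTrace_singleton {T : SimpleGraph V} {u v : V} (h : T.Adj u v) : IsTrace T {s(u, v)} :=
  ⟨u, v, .cons h .nil, by simp [h.ne], by ext; simp⟩

theorem isTrace_pair {T : SimpleGraph V} {u v w : V} (h : T.Adj v u) (h' : T.Adj v w)
    (huw : u ≠ w) : IsTrace T {s(v, u), s(v, w)} :=
  ⟨u, w, .cons h.symm (.cons h' .nil), by simp [h.ne.symm, h'.ne, huw],
    by ext; simp [Sym2.eq_swap (a := u)]⟩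

theorem isTrace_triple {T : SimpleGraph V} {u v w x : V} (h : T.Adj v u) (h' : T.Adj v w)
    (hx : T.Adj w x) (huw : u ≠ w) (hux : u ≠ x) (hvx : v ≠ x) :
    IsTrace T {s(v, u), s(v, w), s(w, x)} :=
  ⟨u, x, .cons h.symm (.cons h' (.cons hx .nil)),
    by simp [h.ne.symm, h'.ne, huw, hux, hvx, hx.ne],
    by ext; simp [Sym2.eq_swap (a := u)]⟩

/-- An inner vertex of a path has two distinct neighbours along it, so a vertex with only one must
be an end. -/
theorem eq_endpoint_of_unique_edge {T : SimpleGraph V} {v w : V} :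
    ∀ {u t : V} (p : T.Walk u t), p.IsPath → v ∈ p.support →
      (∀ w', s(w', v) ∈ p.edges → w' = w) → v = u ∨ v = t
  | _, _, .nil, _, hv, _ => by simpa using hv
  | u, t, .cons (v := x) h q, hp, hv, hw => by
    rw [Walk.cons_isPath_iff] at hp
    rw [Walk.support_cons, List.mem_cons] at hv
    rcases hv with rfl | hv
    · exact Or.inl rfl
    rcases eq_endpoint_of_unique_edge q hp.1 hv (fun w' h' => hw w' (by simp [h'])) with rfl | h'
    · cases q with
      | nil => exact Or.inr rfl
      | @cons _ y _ h' q' =>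
        exfalso
        have h1 := hw u (by simp)
        have h2 := hw y (by simp [Sym2.eq_swap (a := y)])
        apply hp.2
        subst h1 h2
        simp
    · exact Or.inr h'

/-- A path that contains the only edge at `v` can be prolonged by a new edge at `v`. -/
theorem IsTrace.insert_leaf {T : SimpleGraph V} {A : Set (Sym2 V)} (hA : IsTrace T A) {v w l : V}
    (hw : ∀ w', s(w', v) ∈ A → w' = w) (he : s(w, v) ∈ A) (hl : ∀ e ∈ A, l ∉ e)
    (hvl : T.Adj v l) : IsTrace T (insert s(v, l) A) := by
  obtain ⟨u, t, p, hp, rfl⟩ := hA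
  have hv : v ∈ p.support := p.snd_mem_support_of_mem_edges he
  have hlp : l ∉ p.support := by
    intro hlp
    rcases (Walk.mem_support_iff_exists_mem_edges).1 hlp with h | ⟨e, h1, h2⟩
    · subst h
      have hn : ¬ p.Nil := fun h => by
        cases h
        simp at he
      exact hl _ (Walk.mk_penultimate_end_mem_edges hn) (by simp)
    · exact hl e h1 h2
  rcases eq_endpoint_of_unique_edge p hp hv hw with rfl | rfl
  · exact ⟨l, t, .cons hvl.symm p, hp.cons hlp, by ext; simp [Sym2.eq_swap (a := l)]⟩
  · exact ⟨u, l, p.concat hvl, hp.concat hlp hvl, by ext; simp [or_comm]⟩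

/-- A family of paths of `T`, coloured with two colours, that lies in the edge set `E` and separates
the edges of `E`. -/
structure System (T : SimpleGraph V) (E : Set (Sym2 V)) where
  ι : Type
  fin : Fintype ι
  path : ι → Set (Sym2 V)
  color : ι → Bool
  isTrace : ∀ i, IsTrace T (path i)
  sub : ∀ i, path i ⊆ E
  sep : ∀ e ∈ E, ∀ f ∈ E, e ≠ f →
    ∃ i j, color i ≠ color j ∧ (e ∈ path i ∧ f ∉ path i) ∧ (f ∈ path j ∧ e ∉ path j)

namespace System

variable {T : SimpleGraph V} {E E₁ E₂ : Set (Sym2 V)}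

/-- The number of paths, counted with multiplicity. -/
def size (S : System T E) : ℕ := @Fintype.card S.ι S.fin

/-- The edge `e` lies on a path of colour `b`. -/
def Has (S : System T E) (b : Bool) (e : Sym2 V) : Prop := ∃ i, S.color i = b ∧ e ∈ S.path i

/-- Every edge is covered. -/
def Covers (S : System T E) : Prop := ∀ e ∈ E, ∃ b, S.Has b e

/-- Every edge is covered in both colours. -/
def Nice (S : System T E) : Prop := ∀ e ∈ E, ∀ b, S.Has b e

/-- A path of one system never contains an edge of the other, so a mixed pair of edges needs only
two paths of opposite colours, which `hc` supplies. -/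
theorem exists_union (S₁ : System T E₁) (S₂ : System T E₂) (hd : ∀ e ∈ E₁, e ∉ E₂)
    (hc : ∀ e ∈ E₁, ∀ f ∈ E₂, ∃ b, S₁.Has b e ∧ S₂.Has (!b) f) :
    ∃ S : System T (E₁ ∪ E₂), S.size = S₁.size + S₂.size ∧
      (∀ b e, S.Has b e ↔ S₁.Has b e ∨ S₂.Has b e) := by
  have hd' : ∀ e ∈ E₂, e ∉ E₁ := fun e h h' => hd e h' h
  have key : ∀ e ∈ E₁, ∀ f ∈ E₂, ∃ i j, S₁.color i ≠ S₂.color j ∧ (e ∈ S₁.path i ∧ f ∉ S₁.path i)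
      ∧ (f ∈ S₂.path j ∧ e ∉ S₂.path j) := by
    intro e he f hf
    obtain ⟨b, ⟨i, hi, hei⟩, j, hj, hfj⟩ := hc e he f hf
    exact ⟨i, j, by simp [hi, hj], ⟨hei, fun h => hd' f hf (S₁.sub i h)⟩,
      hfj, fun h => hd e he (S₂.sub j h)⟩
  refine ⟨⟨S₁.ι ⊕ S₂.ι, @instFintypeSum _ _ S₁.fin S₂.fin, Sum.elim S₁.path S₂.path,
    Sum.elim S₁.color S₂.color, ?_, ?_, ?_⟩, ?_, ?_⟩
  · rintro (i | i)
    · exact S₁.isTrace i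
    · exact S₂.isTrace i
  · rintro (i | i)
    · exact (S₁.sub i).trans Set.subset_union_left
    · exact (S₂.sub i).trans Set.subset_union_right
  · rintro e (he | he) f (hf | hf) hef
    · obtain ⟨i, j, h⟩ := S₁.sep e he f hf hef
      exact ⟨Sum.inl i, Sum.inl j, h⟩
    · obtain ⟨i, j, h⟩ := key e he f hf
      exact ⟨Sum.inl i, Sum.inr j, h⟩
    · obtain ⟨i, j, h, h1, h2⟩ := key f hf e he
      exact ⟨Sum.inr j, Sum.inl i, h.symm, h2, h1⟩
    · obtain ⟨i, j, h⟩ := S₂.sep e he f hf hef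
      exact ⟨Sum.inr i, Sum.inr j, h⟩
  · simp only [size]
    let := S₁.fin
    let := S₂.fin
    exact Fintype.card_sum
  · intro b e
    constructor
    · rintro ⟨i | i, h⟩
      · exact Or.inl ⟨i, h⟩
      · exact Or.inr ⟨i, h⟩
    · rintro (⟨i, h⟩ | ⟨i, h⟩)
      · exact ⟨Sum.inl i, h⟩
      · exact ⟨Sum.inr i, h⟩

/-- The system obtained from a separating family of subsets of `Fin m` by naming the edges. -/
def ofDesign {m n : ℕ} (φ : Fin m → Sym2 V) (hφ : Function.Injective φ)
    (D : Fin n → Finset (Fin m)) (c : Fin n → Bool)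
    (hD : ∀ x y, x ≠ y → ∃ i j, c i ≠ c j ∧ (x ∈ D i ∧ y ∉ D i) ∧ (y ∈ D j ∧ x ∉ D j))
    (hT : ∀ i, IsTrace T (φ '' (D i : Set (Fin m)))) : System T (Set.range φ) where
  ι := Fin n
  fin := inferInstance
  path i := φ '' (D i : Set (Fin m))
  color := c
  isTrace := hT
  sub _ := Set.image_subset_range _ _
  sep := by
    rintro _ ⟨x, rfl⟩ _ ⟨y, rfl⟩ hxy
    simpa only [hφ.mem_set_image, Finset.mem_coe] using hD x y (fun h => hxy (by rw [h]))

section ofDesign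

variable {m n : ℕ} {φ : Fin m → Sym2 V} {hφ : Function.Injective φ}
    {D : Fin n → Finset (Fin m)} {c : Fin n → Bool}
    {hD : ∀ x y, x ≠ y → ∃ i j, c i ≠ c j ∧ (x ∈ D i ∧ y ∉ D i) ∧ (y ∈ D j ∧ x ∉ D j)}
    {hT : ∀ i, IsTrace T (φ '' (D i : Set (Fin m)))}

@[simp] theorem size_ofDesign : (ofDesign φ hφ D c hD hT).size = n := Fintype.card_fin n

theorem mem_ofDesign {x : Fin m} {i : Fin n} :
    φ x ∈ (ofDesign φ hφ D c hD hT).path i ↔ x ∈ D i :=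
  (hφ.mem_set_image).trans Finset.mem_coe

theorem has_ofDesign {b : Bool} {x : Fin m} :
    (ofDesign φ hφ D c hD hT).Has b (φ x) ↔ ∃ i, c i = b ∧ x ∈ D i :=
  exists_congr fun _ => and_congr Iff.rfl mem_ofDesign

end ofDesign

end System

/-- `E` has a separating system of `n` paths that covers `E`. -/
def CoverNum (T : SimpleGraph V) (E : Set (Sym2 V)) (n : ℕ) : Prop :=
  ∃ S : System T E, S.size = n ∧ S.Covers

/-- `E` has a separating system of `n` paths that covers `E` in both colours. -/
def NiceNum (T : SimpleGraph V) (E : Set (Sym2 V)) (n : ℕ) : Prop :=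
  ∃ S : System T E, S.size = n ∧ S.Nice

variable {T : SimpleGraph V} {E E₁ E₂ : Set (Sym2 V)}

theorem NiceNum.coverNum {n : ℕ} (h : NiceNum T E n) : CoverNum T E n := by
  obtain ⟨S, h1, h2⟩ := h
  exact ⟨S, h1, fun e he => ⟨true, h2 e he _⟩⟩

/-- The asymmetry is what makes the induction work: one colour per edge is enough on one side when
the other side offers both, and the result can be glued again. -/
theorem CoverNum.union {m n : ℕ} (h₁ : CoverNum T E₁ m) (h₂ : NiceNum T E₂ n)
    (hd : ∀ e ∈ E₁, e ∉ E₂) : CoverNum T (E₁ ∪ E₂) (m + n) := by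
  obtain ⟨S₁, rfl, hc₁⟩ := h₁
  obtain ⟨S₂, rfl, hc₂⟩ := h₂
  obtain ⟨S, hS, hH⟩ := S₁.exists_union S₂ hd fun e he f hf => by
    obtain ⟨b, hb⟩ := hc₁ e he
    exact ⟨b, hb, hc₂ f hf _⟩
  refine ⟨S, hS, ?_⟩
  rintro e (he | he)
  · obtain ⟨b, hb⟩ := hc₁ e he
    exact ⟨b, (hH _ _).2 (Or.inl hb)⟩
  · exact ⟨true, (hH _ _).2 (Or.inr (hc₂ e he _))⟩

/-- Gluing also works when neither side has both colours everywhere, provided each side is covered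
in one fixed colour and these two colours are opposite. -/
theorem CoverNum.union_half {b : Bool} (S₁ : System T E₁) (S₂ : System T E₂)
    (h₁ : ∀ e ∈ E₁, S₁.Has b e) (h₂ : ∀ e ∈ E₂, S₂.Has (!b) e)
    (hd : ∀ e ∈ E₁, e ∉ E₂) : CoverNum T (E₁ ∪ E₂) (S₁.size + S₂.size) := by
  obtain ⟨S, hS, hH⟩ := S₁.exists_union S₂ hd fun e he f hf => ⟨b, h₁ e he, h₂ f hf⟩
  refine ⟨S, hS, ?_⟩
  rintro e (he | he)
  · exact ⟨b, (hH _ _).2 (Or.inl (h₁ e he))⟩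
  · exact ⟨!b, (hH _ _).2 (Or.inr (h₂ e he))⟩

end

/-! ### Connected vertex sets and branches in a forest -/

section

variable {V : Type u}

/-- `x` and `y` are joined by a walk of `T` inside `W`. -/
def Linked (T : SimpleGraph V) (W : Finset V) (x y : V) : Prop :=
  ∃ p : T.Walk x y, ∀ z ∈ p.support, z ∈ W

/-- `W` induces a connected subgraph of `T` (or is empty). -/
def Conn (T : SimpleGraph V) (W : Finset V) : Prop := ∀ x ∈ W, ∀ y ∈ W, Linked T W x y

/-- The edges of `T` with both ends in `W`. -/
def edgesIn (T : SimpleGraph V) (W : Finset V) : Set (Sym2 V) :=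
  {e | e ∈ T.edgeSet ∧ ∀ x ∈ e, x ∈ W}

open Classical in
/-- The neighbours of `x` in `W`. -/
noncomputable def nbrs (T : SimpleGraph V) (W : Finset V) (x : V) : Finset V :=
  W.filter (T.Adj x)

variable {T : SimpleGraph V} {W W' : Finset V} {x y z v w a b : V}

@[simp] theorem mk_mem_edgesIn : s(x, y) ∈ edgesIn T W ↔ T.Adj x y ∧ x ∈ W ∧ y ∈ W := by
  simp [edgesIn]

@[simp] theorem mem_nbrs : y ∈ nbrs T W x ↔ y ∈ W ∧ T.Adj x y := by
  simp [nbrs]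

theorem nbrs_mono (h : W ⊆ W') : nbrs T W x ⊆ nbrs T W' x := fun y hy => by
  rw [mem_nbrs] at hy ⊢
  exact ⟨h hy.1, hy.2⟩

theorem edgesIn_mono (h : W ⊆ W') : edgesIn T W ⊆ edgesIn T W' := fun _ he =>
  ⟨he.1, fun x hx => h (he.2 x hx)⟩

theorem Linked.refl (h : x ∈ W) : Linked T W x x := ⟨.nil, by simpa using h⟩

theorem Linked.symm (h : Linked T W x y) : Linked T W y x := by
  obtain ⟨p, hp⟩ := h
  exact ⟨p.reverse, by simpa using hp⟩

theorem Linked.trans (h : Linked T W x y) (h' : Linked T W y z) : Linked T W x z := by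
  obtain ⟨p, hp⟩ := h
  obtain ⟨q, hq⟩ := h'
  refine ⟨p.append q, fun w hw => ?_⟩
  rcases (Walk.mem_support_append_iff _ _).1 hw with h | h
  exacts [hp w h, hq w h]

theorem Linked.left (h : Linked T W x y) : x ∈ W := by
  obtain ⟨p, hp⟩ := h
  exact hp x p.start_mem_support

theorem Linked.right (h : Linked T W x y) : y ∈ W := h.symm.left

theorem Linked.mono (h : Linked T W x y) (hW : W ⊆ W') : Linked T W' x y := by
  obtain ⟨p, hp⟩ := h
  exact ⟨p, fun z hz => hW (hp z hz)⟩

theorem Linked.of_adj (h : T.Adj x y) (hx : x ∈ W) (hy : y ∈ W) : Linked T W x y :=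
  ⟨.cons h .nil, by simp [hx, hy]⟩

theorem Conn.of_center (h : ∀ x ∈ W, Linked T W x v) : Conn T W := fun x hx y hy =>
  (h x hx).trans (h y hy).symm

/-- In a forest, two neighbours of `v` are not linked outside `v`. -/
theorem eq_of_linked (hT : T.IsAcyclic) (ha : T.Adj v a) (hb : T.Adj v b)
    (h : Linked T W a b) (hv : v ∉ W) : a = b := by
  classical
  by_contra hab
  obtain ⟨p, hp⟩ := h
  -- The path from `a` through `v` to `b` is the only one in a forest, so every walk from `a` to `b`
  -- meets `v`.
  have hq : (Walk.cons ha.symm (Walk.cons hb Walk.nil)).IsPath := by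
    simp [ha.ne.symm, hb.ne, hab]
  have := (hT.subsingleton_path a b).elim ⟨p.bypass, p.bypass_isPath⟩ ⟨_, hq⟩
  have hv' : v ∈ p.bypass.support := by
    rw [Subtype.mk.injEq] at this
    rw [this]
    simp
  exact hv (hp v (p.support_bypass_subset_support hv'))

/-- A connected set that is not all of a larger connected set has an outgoing edge. -/
theorem exists_adj_of_ssubset (hW : Conn T W) {S : Finset V} (hS : S ⊆ W) (hne : S.Nonempty)
    (hSW : S ≠ W) : ∃ v ∈ S, ∃ l ∈ W, l ∉ S ∧ T.Adj v l := by
  obtain ⟨x, hx⟩ := hne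
  obtain ⟨y, hyW, hyS⟩ : ∃ y ∈ W, y ∉ S := by
    by_contra! h
    exact hSW (hS.antisymm h)
  obtain ⟨p, hp⟩ := hW x (hS hx) y hyW
  obtain ⟨d, hd, h1, h2⟩ := p.exists_boundary_dart (↑S : Set V) hx hyS
  exact ⟨d.fst, h1, d.snd, hp _ (p.dart_snd_mem_support_of_mem_darts hd), h2, d.adj⟩

theorem Conn.insert [DecidableEq V] (hW : Conn T W) (hv : v ∈ W) (h : T.Adj v a) :
    Conn T (insert a W) := by
  refine Conn.of_center (v := v) fun x hx => ?_
  rcases Finset.mem_insert.1 hx with rfl | hx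
  · exact Linked.of_adj h.symm (by simp) (by simp [hv])
  · exact (hW x hx v hv).mono (by simp)

/-- A second edge from `a` into the connected set `W` would close a cycle, so exactly one edge is
gained. -/
theorem edgesIn_insert [DecidableEq V] (hT : T.IsAcyclic) (hW : Conn T W) (hv : v ∈ W)
    (ha : a ∉ W) (h : T.Adj v a) : edgesIn T (insert a W) = insert s(v, a) (edgesIn T W) := by
  have key : ∀ x ∈ W, T.Adj x a → x = v := fun x hx hxa =>
    eq_of_linked hT hxa.symm h.symm (hW x hx v hv) ha
  ext e
  induction e with | _ x y
  simp only [mk_mem_edgesIn, Set.mem_insert_iff, Finset.mem_insert, Sym2.eq_iff]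
  constructor
  · rintro ⟨hxy, rfl | hx, rfl | hy⟩
    · exact absurd rfl hxy.ne
    · exact Or.inl (Or.inr ⟨rfl, key _ hy hxy.symm⟩)
    · exact Or.inl (Or.inl ⟨key _ hx hxy, rfl⟩)
    · exact Or.inr ⟨hxy, hx, hy⟩
  · rintro ((⟨rfl, rfl⟩ | ⟨rfl, rfl⟩) | ⟨hxy, hx, hy⟩)
    · exact ⟨h, Or.inr hv, Or.inl rfl⟩
    · exact ⟨h.symm, Or.inl rfl, Or.inr hv⟩
    · exact ⟨hxy, Or.inr hx, Or.inr hy⟩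

theorem edgesIn_singleton : edgesIn T {v} = ∅ := by
  ext e
  induction e with | _ x y
  simp only [mk_mem_edgesIn, Finset.mem_singleton, Set.mem_empty_iff_false, iff_false]
  rintro ⟨h, rfl, rfl⟩
  exact h.ne rfl

/-- `A` is a union of branches of `U` at `v`. -/
structure Branching (T : SimpleGraph V) (U : Finset V) (v : V) (A : Finset V) : Prop where
  sub : A ⊆ U
  not_mem : v ∉ A
  closed : ∀ x ∈ A, ∀ y ∈ U, y ≠ v → T.Adj x y → y ∈ A

namespace Branching

variable [DecidableEq V] {U A B : Finset V}

/-- Since `A` can be entered or left only through `v`, a walk to `v` starting outside `A` stays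
outside until it first reaches `v`. -/
theorem linked_compl (hA : Branching T U v A) :
    ∀ {x : V} (p : T.Walk x v), (∀ z ∈ p.support, z ∈ U) → x ∉ A → Linked T (U \ A) x v
  | _, .nil, hp, hx => Linked.refl (by simpa [hx] using hp)
  | x, .cons (v := y) h q, hp, hx => by
    by_cases hxv : x = v
    · subst hxv
      exact Linked.refl (by simpa [hx] using hp x (by simp))
    have hxU := hp x (by simp)
    have hyU := hp y (by simp)
    have hy : y ∉ A := fun hy => hx (hA.closed y hy x hxU hxv h.symm)
    exact (Linked.of_adj h (by simp [hxU, hx]) (by simp [hyU, hy])).trans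
      (hA.linked_compl q (fun z hz => hp z (by simp [hz])) hy)

theorem linked_insert (hA : Branching T U v A) :
    ∀ {x : V} (p : T.Walk x v), (∀ z ∈ p.support, z ∈ U) → x ∈ insert v A →
      Linked T (insert v A) x v
  | _, .nil, hp, hx => Linked.refl hx
  | x, .cons (v := y) h q, hp, hx => by
    by_cases hxv : x = v
    · subst hxv
      exact Linked.refl hx
    have hyU := hp y (by simp)
    have hx' : x ∈ A := by simpa [hxv] using hx
    have hy : y ∈ insert v A := by
      by_cases hyv : y = v
      · simp [hyv]
      · exact Finset.mem_insert_of_mem (hA.closed x hx' y hyU hyv h)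
    exact (Linked.of_adj h hx hy).trans
      (hA.linked_insert q (fun z hz => hp z (by simp [hz])) hy)

theorem conn_compl (hA : Branching T U v A) (hU : Conn T U) (hv : v ∈ U) : Conn T (U \ A) := by
  refine Conn.of_center (v := v) fun x hx => ?_
  rw [Finset.mem_sdiff] at hx
  obtain ⟨p, hp⟩ := hU x hx.1 v hv
  exact hA.linked_compl p hp hx.2

theorem conn_insert (hA : Branching T U v A) (hU : Conn T U) (hv : v ∈ U) :
    Conn T (insert v A) := by
  refine Conn.of_center (v := v) fun x hx => ?_
  obtain ⟨p, hp⟩ := hU x (Finset.insert_subset hv hA.sub hx) v hv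
  exact hA.linked_insert p hp hx

theorem edgesIn_eq (hA : Branching T U v A) (hv : v ∈ U) :
    edgesIn T U = edgesIn T (U \ A) ∪ edgesIn T (insert v A) := by
  apply Set.Subset.antisymm
  · intro e
    induction e with | _ x y
    have hm := hA.not_mem
    rw [mk_mem_edgesIn, Set.mem_union, mk_mem_edgesIn, mk_mem_edgesIn]
    rintro ⟨h, hx, hy⟩
    have h1 := hA.closed x
    have h2 := hA.closed y
    have h3 := h.symm
    simp only [Finset.mem_sdiff, Finset.mem_insert]
    by_cases hxA : x ∈ A <;> by_cases hyA : y ∈ A <;> by_cases hxv : x = v <;>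
      by_cases hyv : y = v <;> grind
  · apply Set.union_subset (edgesIn_mono Finset.sdiff_subset)
    exact edgesIn_mono (Finset.insert_subset hv hA.sub)

theorem edgesIn_disjoint (hA : Branching T U v A) :
    ∀ e ∈ edgesIn T (U \ A), e ∉ edgesIn T (insert v A) := by
  intro e
  induction e with | _ x y
  rw [mk_mem_edgesIn, mk_mem_edgesIn]
  rintro ⟨h, hx, hy⟩ ⟨-, hx', hy'⟩
  simp only [Finset.mem_sdiff, Finset.mem_insert] at hx hy hx' hy'
  rcases hx' with rfl | hx'
  · rcases hy' with rfl | hy'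
    · exact h.ne rfl
    · exact hy.2 hy'
  · exact hx.2 hx'

theorem nbrs_eq (hA : Branching T U v A) (hx : x ∈ A) (hv : v ∈ U) :
    nbrs T (Insert.insert v A) x = nbrs T U x := by
  ext y
  simp only [mem_nbrs, Finset.mem_insert]
  constructor
  · rintro ⟨rfl | hy, h⟩
    exacts [⟨hv, h⟩, ⟨hA.sub hy, h⟩]
  · rintro ⟨hy, h⟩
    refine ⟨?_, h⟩
    by_cases hyv : y = v
    · exact Or.inl hyv
    · exact Or.inr (hA.closed x hx y hy hyv h)

/-- Remove a union of branches that has a system with both colours everywhere. -/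
theorem coverNum {m n : ℕ} (hA : Branching T U v A) (hv : v ∈ U)
    (h₁ : CoverNum T (edgesIn T (U \ A)) m) (h₂ : NiceNum T (edgesIn T (Insert.insert v A)) n) :
    CoverNum T (edgesIn T U) (m + n) := by
  rw [hA.edgesIn_eq hv]
  exact h₁.union h₂ hA.edgesIn_disjoint

end Branching

section branch

variable [DecidableEq V] {U : Finset V}

open Classical in
/-- The vertices of `U` that are linked to `a` without passing through `v`. -/
noncomputable def branch (T : SimpleGraph V) (U : Finset V) (v a : V) : Finset V :=
  U.filter fun x => Linked T (U.erase v) a x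

theorem mem_branch : x ∈ branch T U v a ↔ Linked T (U.erase v) a x := by
  classical
  rw [branch, Finset.mem_filter, and_iff_right_iff_imp]
  exact fun h => Finset.mem_of_mem_erase h.right

theorem self_mem_branch (ha : a ∈ U) (hav : a ≠ v) : a ∈ branch T U v a :=
  mem_branch.2 (Linked.refl (by simp [ha, hav]))

theorem branching_branch : Branching T U v (branch T U v a) where
  sub x hx := Finset.mem_of_mem_erase (mem_branch.1 hx).right
  not_mem h := by simpa using (mem_branch.1 h).right
  closed x hx y hy hyv h := by
    rw [mem_branch] at hx ⊢
    exact hx.trans (Linked.of_adj h hx.right (by simp [hy, hyv]))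

theorem disjoint_branch (hT : T.IsAcyclic) (ha : T.Adj v a) (hb : T.Adj v b) (hab : a ≠ b) :
    Disjoint (branch T U v a) (branch T U v b) := by
  rw [Finset.disjoint_left]
  intro x hx hx'
  rw [mem_branch] at hx hx'
  exact hab (eq_of_linked hT ha hb (hx.trans hx'.symm) (by simp))

theorem eq_of_mem_branch (hT : T.IsAcyclic) (ha : T.Adj v a) (hb : T.Adj v b)
    (h : b ∈ branch T U v a) : b = a :=
  (eq_of_linked hT ha hb (mem_branch.1 h) (by simp)).symm

/-- Every vertex other than `v` lies in the branch of some neighbour of `v`. -/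
theorem exists_mem_branch (hU : Conn T U) (hv : v ∈ U) (hx : x ∈ U) (hxv : x ≠ v) :
    ∃ a ∈ nbrs T U v, x ∈ branch T U v a := by
  obtain ⟨p, hp⟩ := hU v hv x hx
  -- A path from `v` does not return to `v`, so its tail after the first step witnesses membership
  -- in a branch.
  have hb := p.bypass_isPath
  have hs := fun z hz => hp z (p.support_bypass_subset_support hz)
  generalize p.bypass = q at hb hs
  cases q with
  | nil => exact absurd rfl hxv
  | @cons _ a _ h q =>
    rw [Walk.cons_isPath_iff] at hb
    refine ⟨a, mem_nbrs.2 ⟨hs a (by simp), h⟩, mem_branch.2 ⟨q, fun z hz => ?_⟩⟩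
    rw [Finset.mem_erase]
    refine ⟨?_, hs z (by simp [hz])⟩
    rintro rfl
    exact hb.2 hz

end branch

end

/-! ### Growing a system: extension, and the step with one new leaf -/

section

variable {V : Type u} {T : SimpleGraph V} {E F : Set (Sym2 V)}

namespace System

/-- Add new edges `F` to a system: some old paths are prolonged, some new paths are added. -/
theorem exists_extension (S : System T E) (κ : Type) [Fintype κ] (X : S.ι → Set (Sym2 V))
    (N : κ → Set (Sym2 V)) (c : κ → Bool) (hd : ∀ e ∈ F, e ∉ E)
    (hX : ∀ i, X i ⊆ F) (hN : ∀ k, N k ⊆ F) (hXT : ∀ i, IsTrace T (S.path i ∪ X i))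
    (hNT : ∀ k, IsTrace T (N k))
    (hF : ∀ e ∈ F, ∀ f ∈ E, ∃ b, (∃ k, c k = b ∧ e ∈ N k) ∧
      ∃ i, S.color i = !b ∧ f ∈ S.path i ∧ e ∉ X i)
    (hFF : ∀ e ∈ F, ∀ f ∈ F, e ≠ f → ∃ i j, Sum.elim S.color c i ≠ Sum.elim S.color c j ∧
      (e ∈ Sum.elim X N i ∧ f ∉ Sum.elim X N i) ∧ (f ∈ Sum.elim X N j ∧ e ∉ Sum.elim X N j)) :
    ∃ (S' : System T (E ∪ F)) (φ : S.ι → S'.ι) (ψ : κ → S'.ι),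
      S'.size = S.size + Fintype.card κ ∧ Function.Injective φ ∧ Function.Injective ψ ∧
      (∀ i k, φ i ≠ ψ k) ∧ (∀ i, S'.color (φ i) = S.color i) ∧ (∀ k, S'.color (ψ k) = c k) ∧
      (∀ i, S'.path (φ i) = S.path i ∪ X i) ∧ (∀ k, S'.path (ψ k) = N k) := by
  -- In a mixed pair the new edge is seen by a new path, which avoids `E` altogether, and the old
  -- edge by an old path not prolonged by that new edge.
  have key : ∀ e ∈ F, ∀ f ∈ E, ∃ k i, c k ≠ S.color i ∧ (e ∈ N k ∧ f ∉ N k) ∧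
      (f ∈ S.path i ∪ X i ∧ e ∉ S.path i ∪ X i) := by
    intro e he f hf
    obtain ⟨b, ⟨k, hk, hek⟩, i, hi, hfi, hei⟩ := hF e he f hf
    refine ⟨k, i, by simp [hk, hi], ⟨hek, fun h => hd f (hN k h) hf⟩, Or.inl hfi, ?_⟩
    rintro (h | h)
    exacts [hd e he (S.sub i h), hei h]
  refine ⟨⟨S.ι ⊕ κ, @instFintypeSum _ _ S.fin _, Sum.elim (fun i => S.path i ∪ X i) N,
    Sum.elim S.color c, ?_, ?_, ?_⟩, Sum.inl, Sum.inr, ?_, Sum.inl_injective, Sum.inr_injective,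
    by simp, fun _ => rfl, fun _ => rfl, fun _ => rfl, fun _ => rfl⟩
  · rintro (i | k)
    exacts [hXT i, hNT k]
  · rintro (i | k)
    · exact Set.union_subset_union (S.sub i) (hX i)
    · exact (hN k).trans Set.subset_union_right
  · rintro e (he | he) f (hf | hf) hef
    · obtain ⟨i, j, h1, ⟨h2, h3⟩, h4, h5⟩ := S.sep e he f hf hef
      refine ⟨Sum.inl i, Sum.inl j, h1, ⟨Or.inl h2, ?_⟩, Or.inl h4, ?_⟩
      · rintro (h | h)
        exacts [h3 h, hd f (hX i h) hf]
      · rintro (h | h)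
        exacts [h5 h, hd e (hX j h) he]
    · obtain ⟨k, i, h, h1, h2⟩ := key f hf e he
      exact ⟨Sum.inl i, Sum.inr k, h.symm, h2, h1⟩
    · obtain ⟨k, i, h, h1, h2⟩ := key e he f hf
      exact ⟨Sum.inr k, Sum.inl i, h, h1, h2⟩
    · obtain ⟨i, j, h, h1, h2⟩ := hFF e he f hf hef
      have hm : ∀ e ∈ F, ∀ i, e ∈ Sum.elim (fun i => S.path i ∪ X i) N i ↔
          e ∈ Sum.elim X N i := by
        rintro e he (i | k)
        · exact ⟨fun h => h.resolve_left fun h => hd e he (S.sub i h), Or.inr⟩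
        · exact Iff.rfl
      refine ⟨i, j, h, ?_⟩
      rw [hm e he, hm e he, hm f hf, hm f hf]
      exact ⟨h1, h2⟩
  · simp only [size]
    let := S.fin
    exact Fintype.card_sum

end System

/-- `v ∈ S` has a neighbour in `U` outside `S`. -/
def Active (T : SimpleGraph V) (U S : Finset V) (v : V) : Prop :=
  v ∈ S ∧ ∃ l ∈ U, l ∉ S ∧ T.Adj v l

/-- A system on the edges inside `S` that can be grown at every active vertex: active vertices `v`
are leaves of `S`, and paths `J v` and `K v` of distinct colours end there, where `J v` is not
needed to cover any edge in its colour. -/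
structure Growing (T : SimpleGraph V) (U S : Finset V) (Q : System T E) (J K : V → Q.ι) :
    Prop where
  edges : E = edgesIn T S
  nice : Q.Nice
  inj : ∀ v v', Active T U S v → Active T U S v' → J v = J v' → v = v'
  color_ne : ∀ v, Active T U S v → Q.color (J v) ≠ Q.color (K v)
  leaf : ∀ v, Active T U S v → ∃ w ∈ S, T.Adj w v ∧ (∀ w' ∈ S, T.Adj w' v → w' = w) ∧
    s(w, v) ∈ Q.path (J v) ∧ s(w, v) ∈ Q.path (K v)
  spare : ∀ v, Active T U S v → ∀ f ∈ E, ∃ i ≠ J v, Q.color i = Q.color (J v) ∧ f ∈ Q.path i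

theorem isTrace_union_of_leaf {S : Finset V} (Q : System T (edgesIn T S)) {v w l : V} {i : Q.ι}
    (hw : ∀ w' ∈ S, T.Adj w' v → w' = w) (he : s(w, v) ∈ Q.path i) (hl : l ∉ S)
    (h : T.Adj v l) : IsTrace T (Q.path i ∪ {s(v, l)}) := by
  rw [Set.union_singleton]
  refine (Q.isTrace i).insert_leaf (w := w) ?_ he ?_ h
  · intro w' hw'
    have := mk_mem_edgesIn.1 (Q.sub i hw')
    exact hw w' this.2.1 this.1
  · intro e he hle
    exact hl ((Q.sub i he).2 l hle)

section step

variable [DecidableEq V] {U S : Finset V} {Q : System T E} {J K : V → Q.ι} {v l l' : V}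

/-- Both `J v` and `K v` are prolonged by `vl`, and the single edge `vl` is added as a path in the
colour of `K v`. To separate `vl` from an old edge `f`, the new path is paired with a path through
`f` in the colour of `J v` other than `J v`; it exists because `J v` is spare, and it was not
prolonged. -/
theorem Growing.step_one (hT : T.IsAcyclic) (hS : Conn T S) (hG : Growing T U S Q J K)
    (hv : Active T U S v) (hl : l ∉ S) (hvl : T.Adj v l)
    (hall : ∀ x ∈ U, T.Adj v x → x ∈ insert l S) :
    ∃ (E' : Set (Sym2 V)) (Q' : System T E') (J' K' : V → Q'.ι),
      Growing T U (insert l S) Q' J' K' ∧ Q'.size = Q.size + 1 := by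
  obtain rfl := hG.edges
  have hvS := hv.1
  obtain ⟨w, hw, hwv, huniq, hJ, hK⟩ := hG.leaf v hv
  have hJK := hG.color_ne v hv
  have hsp := hG.spare v hv
  have hlS : ∀ e ∈ edgesIn T S, e ≠ s(v, l) := by
    rintro e he rfl
    exact hl (he.2 l (by simp))
  obtain ⟨Q', φ, ψ, hsize, hφ, -, hφψ, hcφ, hcψ, hpφ, hpψ⟩ :=
    Q.exists_extension (F := {s(v, l)}) Unit (fun i => {e | e = s(v, l) ∧ (i = J v ∨ i = K v)})
      (fun _ => {s(v, l)}) (fun _ => Q.color (K v)) (by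
        rintro e rfl h
        exact hlS _ h rfl) (fun i e he => he.1) (fun _ => subset_rfl) (by
        intro i
        by_cases hi : i = J v ∨ i = K v
        · have : {e | e = s(v, l) ∧ (i = J v ∨ i = K v)} = {s(v, l)} := by
            ext
            simp [hi]
          rw [this]
          refine isTrace_union_of_leaf Q huniq ?_ hl hvl
          rcases hi with rfl | rfl
          exacts [hJ, hK]
        · have : {e | e = s(v, l) ∧ (i = J v ∨ i = K v)} = ∅ := by
            ext
            simp [hi]
          rw [this, Set.union_empty]
          exact Q.isTrace i) (fun _ => isTrace_singleton hvl) (by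
        rintro e rfl f hf
        obtain ⟨i, hi, hci, hfi⟩ := hsp f hf
        refine ⟨Q.color (K v), ⟨(), rfl, rfl⟩, i, ?_, hfi, ?_⟩
        · rw [hci]
          exact Bool.eq_not_of_ne hJK
        · rintro ⟨-, rfl | rfl⟩
          exacts [hi rfl, hJK hci.symm]) (by
        rintro e rfl f rfl h
        exact absurd rfl h)
  have hedges : edgesIn T S ∪ {s(v, l)} = edgesIn T (insert l S) := by
    rw [edgesIn_insert hT hS hvS hl hvl, Set.union_singleton]
  have hnbr : ∀ x ∈ S, T.Adj x l → x = v := fun x hx hxl =>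
    eq_of_linked hT hxl.symm hvl.symm (hS x hx v hvS) hl
  have hact : ∀ x, Active T U (insert l S) x → x ≠ l → Active T U S x ∧ x ≠ v := by
    rintro x ⟨hx, y, hyU, hyS, hxy⟩ hxl
    refine ⟨⟨by simpa [hxl] using hx, y, hyU, fun h => hyS (by simp [h]), hxy⟩, ?_⟩
    rintro rfl
    exact hyS (hall y hyU hxy)
  -- At `l` the new path is the spare one, since the prolonged `K v` also covers `vl` in its colour;
  -- the prolonged `J v` is its partner.
  refine ⟨_, Q', fun x => if x = l then ψ () else φ (J x), fun x => if x = l then φ (J v) else φ (K x),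
    ⟨hedges, ?_, ?_, ?_, ?_, ?_⟩, by simpa using hsize⟩
  · rintro e (he | rfl) b
    · obtain ⟨i, hi, hei⟩ := hG.nice e he b
      exact ⟨φ i, by rw [hcφ, hi], by rw [hpφ]; exact Or.inl hei⟩
    · by_cases hb : Q.color (J v) = b
      · exact ⟨φ (J v), by rw [hcφ, hb], by rw [hpφ]; exact Or.inr ⟨rfl, Or.inl rfl⟩⟩
      · refine ⟨ψ (), ?_, by rw [hpψ]; rfl⟩
        rw [hcψ]
        cases b <;> cases h1 : Q.color (J v) <;> cases h2 : Q.color (K v) <;> simp_all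
  · intro x x' hx hx' h
    by_cases h1 : x = l <;> by_cases h2 : x' = l
    · rw [h1, h2]
    · simp only [h1, h2, if_true, if_false] at h
      exact absurd h.symm (hφψ _ _)
    · simp only [h1, h2, if_true, if_false] at h
      exact absurd h (hφψ _ _)
    · simp only [h1, h2, if_false] at h
      exact hG.inj x x' (hact x hx h1).1 (hact x' hx' h2).1 (hφ h)
  · intro x hx
    by_cases h1 : x = l
    · simpa only [h1, if_true, hcψ, hcφ] using hJK.symm
    · simpa only [h1, if_false, hcφ] using hG.color_ne x (hact x hx h1).1
  · intro x hx
    by_cases h1 : x = l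
    · subst h1
      refine ⟨v, by simp [hvS], hvl, ?_, ?_⟩
      · intro w' hw' h
        rcases Finset.mem_insert.1 hw' with rfl | hw'
        · exact absurd rfl h.ne
        · exact hnbr w' hw' h
      · simp only [if_true, hpψ, hpφ]
        exact ⟨rfl, Or.inr (by simp)⟩
    · obtain ⟨hx', hxv⟩ := hact x hx h1
      obtain ⟨w, hw, hwx, hu, h2, h3⟩ := hG.leaf x hx'
      refine ⟨w, by simp [hw], hwx, ?_, ?_⟩
      · intro w' hw' h
        rcases Finset.mem_insert.1 hw' with rfl | hw'
        · exact absurd (hnbr x hx'.1 h.symm) hxv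
        · exact hu w' hw' h
      · simp only [h1, if_false, hpφ]
        exact ⟨Or.inl h2, Or.inl h3⟩
  · intro x hx f hf
    by_cases h1 : x = l
    · simp only [h1, if_true, hcψ]
      rcases hf with hf | rfl
      · obtain ⟨i, hi, hei⟩ := hG.nice f hf (Q.color (K v))
        exact ⟨φ i, hφψ _ _, by rw [hcφ, hi], by rw [hpφ]; exact Or.inl hei⟩
      · exact ⟨φ (K v), hφψ _ _, hcφ _, by rw [hpφ]; exact Or.inr ⟨rfl, Or.inr rfl⟩⟩
    · obtain ⟨hx', hxv⟩ := hact x hx h1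
      simp only [h1, if_false, hcφ]
      rcases hf with hf | rfl
      · obtain ⟨i, hi, hci, hfi⟩ := hG.spare x hx' f hf
        exact ⟨φ i, fun h => hi (hφ h), by rw [hcφ, hci], by rw [hpφ]; exact Or.inl hfi⟩
      -- Injectivity of `J` matters here: the prolonged `J v` can cover `vl` in place of `J x`
      -- because the two differ.
      · by_cases hc : Q.color (J v) = Q.color (J x)
        · refine ⟨φ (J v), fun h => hxv (hG.inj v x hv hx' (hφ h)).symm, by rw [hcφ, hc], ?_⟩
          rw [hpφ]
          exact Or.inr ⟨rfl, Or.inl rfl⟩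
        · refine ⟨ψ (), (hφψ _ _).symm, ?_, by rw [hpψ]; rfl⟩
          rw [hcψ]
          cases h1 : Q.color (J v) <;> cases h2 : Q.color (K v) <;>
            cases h3 : Q.color (J x) <;> simp_all

end step

end

/-! ### Growing a system: two new leaves, and filling the whole tree -/

section

variable {V : Type u} {T : SimpleGraph V} {E F : Set (Sym2 V)}

section step

variable [DecidableEq V] {U S : Finset V} {Q : System T E} {J K : V → Q.ι} {v l l' : V}

/-- Besides `J v` and `K v`, a third path `I` in the colour of `J v` uses the leaf edge, because `J
v` is spare. The first two are prolonged by `vl` and `I` by `vl'`, so that `K v` and `I` separate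
the new edges from each other. The path with edges `vl`, `vl'` is added once in each colour and
separates the new edges from the old ones. -/
theorem Growing.step_two (hT : T.IsAcyclic) (hS : Conn T S) (hG : Growing T U S Q J K)
    (hv : Active T U S v) (hl : l ∉ S) (hvl : T.Adj v l) (hl' : l' ∉ S) (hvl' : T.Adj v l')
    (hll' : l ≠ l') (hall : ∀ x ∈ U, T.Adj v x → x ∈ insert l' (insert l S)) :
    ∃ (E' : Set (Sym2 V)) (Q' : System T E') (J' K' : V → Q'.ι),
      Growing T U (insert l' (insert l S)) Q' J' K' ∧ Q'.size = Q.size + 2 := by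
  obtain rfl := hG.edges
  have hvS := hv.1
  obtain ⟨w, hw, hwv, huniq, hJ, hK⟩ := hG.leaf v hv
  have hJK := hG.color_ne v hv
  have hsp := hG.spare v hv
  obtain ⟨I, hIJ, hcI, hI⟩ := hsp s(w, v) (mk_mem_edgesIn.2 ⟨hwv, hw, hvS⟩)
  have hIK : I ≠ K v := by
    rintro rfl
    exact hJK hcI.symm
  have hJK' : J v ≠ K v := fun h => hJK (by rw [h])
  have hab : s(v, l) ≠ s(v, l') := by
    intro h
    rw [Sym2.eq_iff] at h
    rcases h with h | h
    exacts [hll' h.2, hvl.ne h.2.symm]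
  have hlS : s(v, l) ∉ edgesIn T S := fun h => hl (h.2 l (by simp))
  have hlS' : s(v, l') ∉ edgesIn T S := fun h => hl' (h.2 l' (by simp))
  set a := s(v, l) with ha
  set b := s(v, l') with hb
  let X : Q.ι → Set (Sym2 V) := fun i =>
    {e | (e = a ∧ (i = J v ∨ i = K v)) ∨ (e = b ∧ i = I)}
  have haX : ∀ i, a ∈ X i ↔ i = J v ∨ i = K v := fun i => by simp [X, hab]
  have hbX : ∀ i, b ∈ X i ↔ i = I := fun i => by simp [X, hab.symm]
  obtain ⟨Q', φ, ψ, hsize, hφ, hψ, hφψ, hcφ, hcψ, hpφ, hpψ⟩ :=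
    Q.exists_extension (F := {a, b}) Bool X
      (fun _ => {a, b}) (fun t => bif t then Q.color (K v) else Q.color (J v)) (by
        rintro e (rfl | rfl)
        exacts [hlS, hlS']) (by
        rintro i e (⟨rfl, -⟩ | ⟨rfl, -⟩)
        · exact Or.inl rfl
        · exact Or.inr rfl) (fun _ => subset_rfl) (by
        intro i
        by_cases hi : i = J v ∨ i = K v
        · have : X i = {a} := by
            ext e
            simp only [X, Set.mem_ofPred_eq, hi, Set.mem_singleton_iff, and_true, or_iff_left_iff_imp,
              and_imp]
            rintro - rfl
            rcases hi with h | h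
            exacts [absurd h hIJ, absurd h hIK]
          rw [this]
          refine isTrace_union_of_leaf Q huniq ?_ hl hvl
          rcases hi with rfl | rfl
          exacts [hJ, hK]
        · by_cases hi' : i = I
          · have : X i = {b} := by
              ext e
              simp only [X, Set.mem_ofPred_eq, hi', Set.mem_singleton_iff, and_true,
                or_iff_right_iff_imp]
              rintro ⟨-, h⟩
              exact absurd (by rwa [hi']) hi
            rw [this, hi']
            exact isTrace_union_of_leaf Q huniq hI hl' hvl'
          · have : X i = ∅ := by
              ext e
              simp [X, hi, hi']
            rw [this, Set.union_empty]
            exact Q.isTrace i) (fun _ => isTrace_pair hvl hvl' hll') (by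
        rintro e (rfl | rfl) f hf
        · obtain ⟨i, hi, hci, hfi⟩ := hsp f hf
          refine ⟨Q.color (K v), ⟨true, rfl, Or.inl rfl⟩, i, ?_, hfi, ?_⟩
          · rw [hci]
            exact Bool.eq_not_of_ne hJK
          · rw [haX]
            rintro (rfl | rfl)
            exacts [hi rfl, hJK hci.symm]
        · obtain ⟨i, hci, hfi⟩ := hG.nice f hf (Q.color (K v))
          refine ⟨Q.color (J v), ⟨false, rfl, Or.inr rfl⟩, i, ?_, hfi, ?_⟩
          · rw [hci]
            exact Bool.eq_not_of_ne hJK.symm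
          · rw [hbX]
            rintro rfl
            exact hJK (hcI.symm.trans hci)) (by
        have h1 : b ∉ X (K v) := by
          rw [hbX]
          exact hIK.symm
        have h2 : a ∉ X I := by
          rw [haX]
          rintro (h | h)
          exacts [hIJ h, hIK h]
        have h3 : a ∈ X (K v) := (haX _).2 (Or.inr rfl)
        have h4 : b ∈ X I := (hbX _).2 rfl
        have h5 : Q.color I ≠ Q.color (K v) := by rwa [hcI]
        rintro e (rfl | rfl) f (rfl | rfl) h
        · exact absurd rfl h
        · exact ⟨Sum.inl (K v), Sum.inl I, h5.symm, ⟨h3, h1⟩, h4, h2⟩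
        · exact ⟨Sum.inl I, Sum.inl (K v), h5, ⟨h4, h2⟩, h3, h1⟩
        · exact absurd rfl h)
  have hpa : ∀ i, (i = J v ∨ i = K v) → a ∈ Q'.path (φ i) := fun i hi => by
    rw [hpφ]
    exact Or.inr ((haX i).2 hi)
  have hpb : b ∈ Q'.path (φ I) := by
    rw [hpφ]
    exact Or.inr ((hbX I).2 rfl)
  have hpo : ∀ i e, e ∈ Q.path i → e ∈ Q'.path (φ i) := fun i e he => by
    rw [hpφ]
    exact Or.inl he
  have hna : ∀ t, a ∈ Q'.path (ψ t) := fun t => by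
    rw [hpψ]
    exact Or.inl rfl
  have hnb : ∀ t, b ∈ Q'.path (ψ t) := fun t => by
    rw [hpψ]
    exact Or.inr rfl
  have hcK : Q'.color (ψ true) = Q.color (K v) := hcψ _
  have hcJ : Q'.color (ψ false) = Q.color (J v) := hcψ _
  have hcol : ∀ c, c = Q.color (J v) ∨ c = Q.color (K v) := by
    intro c
    cases c <;> cases h1 : Q.color (J v) <;> cases h2 : Q.color (K v) <;> simp_all
  have hS1 : Conn T (insert l S) := hS.insert hvS hvl
  have hl'1 : l' ∉ insert l S := by simp [hll'.symm, hl']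
  have hedges : edgesIn T S ∪ {a, b} = edgesIn T (insert l' (insert l S)) := by
    rw [edgesIn_insert hT hS1 (by simp [hvS]) hl'1 hvl', edgesIn_insert hT hS hvS hl hvl]
    ext e
    simp only [Set.mem_union, Set.mem_insert_iff, Set.mem_singleton_iff]
    tauto
  have hnbr : ∀ x ∈ S, T.Adj x l → x = v := fun x hx hxl =>
    eq_of_linked hT hxl.symm hvl.symm (hS x hx v hvS) hl
  have hnbr' : ∀ x ∈ insert l S, T.Adj x l' → x = v := fun x hx hxl =>
    eq_of_linked hT hxl.symm hvl'.symm (hS1 x hx v (by simp [hvS])) hl'1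
  have hact : ∀ x, Active T U (insert l' (insert l S)) x → x ≠ l → x ≠ l' →
      Active T U S x ∧ x ≠ v := by
    rintro x ⟨hx, y, hyU, hyS, hxy⟩ hxl hxl'
    refine ⟨⟨by simpa [hxl, hxl'] using hx, y, hyU, fun h => hyS (by simp [h]), hxy⟩, ?_⟩
    rintro rfl
    exact hyS (hall y hyU hxy)
  -- The spare paths at `l` and `l'` must differ, so `l` keeps `J v` and `l'` takes the new path of
  -- the same colour. The partner `ψ true` may be shared, as only `J` has to be injective.
  refine ⟨_, Q', fun x => if x = l then φ (J v) else if x = l' then ψ false else φ (J x),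
    fun x => if x = l then ψ true else if x = l' then ψ true else φ (K x),
    ⟨hedges, ?_, ?_, ?_, ?_, ?_⟩, by simpa using hsize⟩
  · rintro e (he | rfl | rfl) c
    · obtain ⟨i, hi, hei⟩ := hG.nice e he c
      exact ⟨φ i, by rw [hcφ, hi], hpo _ _ hei⟩
    · rcases hcol c with rfl | rfl
      exacts [⟨_, hcJ, hna _⟩, ⟨_, hcK, hna _⟩]
    · rcases hcol c with rfl | rfl
      exacts [⟨_, hcJ, hnb _⟩, ⟨_, hcK, hnb _⟩]
  · intro x x' hx hx' h
    have hne : ∀ x, Active T U (insert l' (insert l S)) x → x ≠ l → x ≠ l' → J x ≠ J v := by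
      intro x hx h1 h2 h3
      have := hact x hx h1 h2
      exact this.2 (hG.inj x v this.1 hv h3)
    by_cases h1 : x = l
    · by_cases h2 : x' = l
      · rw [h1, h2]
      · by_cases h3 : x' = l'
        · simp only [h1, h3, hll'.symm, if_true, if_false] at h
          exact absurd h (hφψ _ _)
        · simp only [h1, h2, h3, if_true, if_false] at h
          exact absurd (hφ h).symm (hne x' hx' h2 h3)
    · by_cases h1' : x = l'
      · by_cases h2 : x' = l
        · simp only [h1', h2, hll'.symm, if_true, if_false] at h
          exact absurd h.symm (hφψ _ _)
        · by_cases h3 : x' = l'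
          · rw [h1', h3]
          · simp only [h1', h2, h3, hll'.symm, if_true, if_false] at h
            exact absurd h.symm (hφψ _ _)
      · by_cases h2 : x' = l
        · simp only [h1, h1', h2, if_true, if_false] at h
          exact absurd (hφ h) (hne x hx h1 h1')
        · by_cases h3 : x' = l'
          · simp only [h1, h1', h3, hll'.symm, if_true, if_false] at h
            exact absurd h (hφψ _ _)
          · simp only [h1, h1', h2, h3, if_false] at h
            exact hG.inj x x' (hact x hx h1 h1').1 (hact x' hx' h2 h3).1 (hφ h)
  · intro x hx
    by_cases h1 : x = l
    · simpa only [h1, if_true, hcK, hcφ] using hJK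
    · by_cases h2 : x = l'
      · simpa only [h2, hll'.symm, if_true, if_false, hcK, hcJ] using hJK
      · simpa only [h1, h2, if_false, hcφ] using hG.color_ne x (hact x hx h1 h2).1
  · intro x hx
    by_cases h1 : x = l
    · rw [h1]
      refine ⟨v, by simp [hvS], hvl, ?_, ?_⟩
      · intro w' hw' h
        rcases Finset.mem_insert.1 hw' with rfl | hw'
        · exact absurd (hnbr' l (by simp) h.symm) hvl.ne.symm
        · rcases Finset.mem_insert.1 hw' with rfl | hw'
          · exact absurd rfl h.ne
          · exact hnbr w' hw' h
      · simp only [if_true]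
        exact ⟨hpa _ (Or.inl rfl), hna _⟩
    by_cases h2 : x = l'
    · rw [h2]
      refine ⟨v, by simp [hvS], hvl', ?_, ?_⟩
      · intro w' hw' h
        rcases Finset.mem_insert.1 hw' with rfl | hw'
        · exact absurd rfl h.ne
        · exact hnbr' w' hw' h
      · simp only [hll'.symm, if_true, if_false]
        exact ⟨hnb _, hnb _⟩
    · obtain ⟨hx', hxv⟩ := hact x hx h1 h2
      obtain ⟨w, hw, hwx, hu, h3, h4⟩ := hG.leaf x hx'
      refine ⟨w, by simp [hw], hwx, ?_, ?_⟩
      · intro w' hw' h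
        rcases Finset.mem_insert.1 hw' with rfl | hw'
        · exact absurd (hnbr' x (by simp [hx'.1]) h.symm) hxv
        · rcases Finset.mem_insert.1 hw' with rfl | hw'
          · exact absurd (hnbr x hx'.1 h.symm) hxv
          · exact hu w' hw' h
      · simp only [h1, h2, if_false]
        exact ⟨hpo _ _ h3, hpo _ _ h4⟩
  · intro x hx f hf
    by_cases h1 : x = l
    · simp only [h1, if_true, hcφ]
      rcases hf with hf | rfl | rfl
      · obtain ⟨i, hi, hci, hfi⟩ := hsp f hf
        exact ⟨φ i, fun h => hi (hφ h), by rw [hcφ, hci], hpo _ _ hfi⟩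
      · exact ⟨ψ false, (hφψ _ _).symm, hcJ, hna _⟩
      · exact ⟨ψ false, (hφψ _ _).symm, hcJ, hnb _⟩
    by_cases h2 : x = l'
    · simp only [h2, hll'.symm, if_true, if_false, hcJ]
      rcases hf with hf | rfl | rfl
      · obtain ⟨i, hci, hfi⟩ := hG.nice f hf (Q.color (J v))
        exact ⟨φ i, hφψ _ _, by rw [hcφ, hci], hpo _ _ hfi⟩
      · exact ⟨φ (J v), hφψ _ _, hcφ _, hpa _ (Or.inl rfl)⟩
      · exact ⟨φ I, hφψ _ _, by rw [hcφ, hcI], hpb⟩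
    · obtain ⟨hx', hxv⟩ := hact x hx h1 h2
      simp only [h1, h2, if_false, hcφ]
      rcases hf with hf | hf
      · obtain ⟨i, hi, hci, hfi⟩ := hG.spare x hx' f hf
        exact ⟨φ i, fun h => hi (hφ h), by rw [hcφ, hci], hpo _ _ hfi⟩
      · have hf' : ∀ t, f ∈ Q'.path (ψ t) := by
          rcases hf with rfl | rfl
          exacts [hna, hnb]
        rcases hcol (Q.color (J x)) with hc | hc
        · exact ⟨ψ false, (hφψ _ _).symm, by rw [hcJ, hc], hf' _⟩
        · exact ⟨ψ true, (hφψ _ _).symm, by rw [hcK, hc], hf' _⟩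

/-- Grow a system until it fills `U`. -/
theorem Growing.niceNum (hT : T.IsAcyclic) (hU : Conn T U) :
    ∀ (n : ℕ) {E : Set (Sym2 V)} {S : Finset V} {Q : System T E} {J K : V → Q.ι},
      (U \ S).card = n → S ⊆ U → S.Nonempty → Conn T S → Growing T U S Q J K →
      (∀ x ∈ U, nbrs T U x ⊆ S ∨ (nbrs T U x).card ≤ 3) →
      NiceNum T (edgesIn T U) (Q.size + (U \ S).card) := by
  intro n
  induction n using Nat.strong_induction_on with
  | _ n ih =>
  intro E S Q J K hn hSU hne hS hG hdeg
  by_cases hSe : S = U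
  · subst hSe
    obtain rfl := hG.edges
    exact ⟨Q, by simp, hG.nice⟩
  obtain ⟨v, hv, l, hlU, hl, hvl⟩ := exists_adj_of_ssubset hU hSU hne hSe
  have hact : Active T U S v := ⟨hv, l, hlU, hl, hvl⟩
  obtain ⟨w, hw, hwv, -⟩ := hG.leaf v hact
  have hcard : (nbrs T U v).card ≤ 3 := (hdeg v (hSU hv)).resolve_left fun h =>
    hl (h (mem_nbrs.2 ⟨hlU, hvl⟩))
  have hwl : w ≠ l := fun h => hl (h ▸ hw)
  -- One of the at most three neighbours of `v` is `w` in `S`, so one or two are missing. All are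
  -- added at once, after which `v` is no longer active.
  by_cases hall : ∀ x ∈ U, T.Adj v x → x ∈ insert l S
  · obtain ⟨E', Q', J', K', hG', hs⟩ := hG.step_one hT hS hact hl hvl hall
    have hlU' : l ∈ U \ S := by simp [hlU, hl]
    have hc : (U \ insert l S).card + 1 = (U \ S).card := by
      have h1 : U \ insert l S = (U \ S).erase l := by
        ext x
        simp only [Finset.mem_sdiff, Finset.mem_insert, Finset.mem_erase]
        tauto
      rw [h1, Finset.card_erase_add_one hlU']
    have := ih _ (by omega) rfl (Finset.insert_subset hlU hSU) (by simp) (hS.insert hv hvl) hG'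
      fun x hx => (hdeg x hx).imp (fun h => h.trans (Finset.subset_insert _ _)) id
    rwa [hs, show Q.size + 1 + (U \ insert l S).card = Q.size + (U \ S).card by omega] at this
  · push Not at hall
    obtain ⟨l', hlU', hvl', hl'⟩ := hall
    have hl'S : l' ∉ S := fun h => hl' (by simp [h])
    have hll' : l ≠ l' := fun h => hl' (by simp [h])
    have hwl' : w ≠ l' := fun h => hl'S (h ▸ hw)
    have h3 : ({w, l, l'} : Finset V) = nbrs T U v := by
      apply Finset.eq_of_subset_of_card_le
      · intro x hx
        simp only [Finset.mem_insert, Finset.mem_singleton] at hx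
        rcases hx with rfl | rfl | rfl
        exacts [mem_nbrs.2 ⟨hSU hw, hwv.symm⟩, mem_nbrs.2 ⟨hlU, hvl⟩, mem_nbrs.2 ⟨hlU', hvl'⟩]
      · rwa [Finset.card_eq_three.2 ⟨w, l, l', hwl, hwl', hll', rfl⟩]
    obtain ⟨E', Q', J', K', hG', hs⟩ := hG.step_two hT hS hact hl hvl hl'S hvl' hll' (by
      intro x hx hvx
      have : x ∈ ({w, l, l'} : Finset V) := by
        rw [h3]
        exact mem_nbrs.2 ⟨hx, hvx⟩
      simp only [Finset.mem_insert, Finset.mem_singleton] at this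
      rcases this with rfl | rfl | rfl <;> simp [hw])
    have hc : (U \ insert l' (insert l S)).card + 2 = (U \ S).card := by
      have h1 : l ∈ U \ S := by simp [hlU, hl]
      have h2 : l' ∈ (U \ S).erase l := by simp [hlU', hl'S, hll'.symm]
      have h4 := Finset.card_erase_add_one h1
      have h5 := Finset.card_erase_add_one h2
      have h6 : U \ insert l' (insert l S) = ((U \ S).erase l).erase l' := by
        ext x
        simp only [Finset.mem_sdiff, Finset.mem_insert, Finset.mem_erase]
        tauto
      rw [h6]
      omega
    have := ih _ (by omega) rfl (Finset.insert_subset hlU' (Finset.insert_subset hlU hSU))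
      (by simp) ((hS.insert hv hvl).insert (by simp [hv]) hvl') hG'
      fun x hx => (hdeg x hx).imp (fun h => h.trans (by
        exact (Finset.subset_insert _ _).trans (Finset.subset_insert _ _))) id
    rwa [hs, show Q.size + 2 + (U \ insert l' (insert l S)).card = Q.size + (U \ S).card by
      omega] at this

end step

end

/-! ### Stars and the starting systems of the growth -/

section

variable {V : Type u} {T : SimpleGraph V}

theorem isTrace_star {m : ℕ} {v : V} {y : Fin m → V} (hy : Function.Injective y)
    (ha : ∀ i, T.Adj v (y i)) {D : Finset (Fin m)} (hD : D.card = 1 ∨ D.card = 2) :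
    IsTrace T ((fun i => s(v, y i)) '' (D : Set (Fin m))) := by
  rcases hD with hD | hD
  · obtain ⟨i, rfl⟩ := Finset.card_eq_one.1 hD
    simpa using isTrace_singleton (ha i)
  · obtain ⟨i, j, hij, rfl⟩ := Finset.card_eq_two.1 hD
    simpa [Set.image_pair] using isTrace_pair (ha i) (ha j) (hy.ne hij)

theorem star_injective {m : ℕ} {v : V} {y : Fin m → V} (hy : Function.Injective y)
    (ha : ∀ i, T.Adj v (y i)) : Function.Injective fun i => s(v, y i) := by
  intro i j h
  rcases Sym2.eq_iff.1 h with h | h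
  · exact hy h.2
  · exact absurd h.1 (ha j).ne

theorem edgesIn_star [DecidableEq V] (hT : T.IsAcyclic) {m : ℕ} {v : V} {y : Fin m → V}
    (ha : ∀ i, T.Adj v (y i)) :
    edgesIn T (insert v (Finset.univ.image y)) = Set.range fun i => s(v, y i) := by
  ext e
  induction e with | _ a b
  simp only [mk_mem_edgesIn, Finset.mem_insert, Finset.mem_image, Finset.mem_univ, true_and,
    Set.mem_range, Sym2.eq_iff]
  constructor
  · rintro ⟨hab, rfl | ⟨i, rfl⟩, rfl | ⟨j, rfl⟩⟩
    · exact absurd rfl hab.ne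
    · exact ⟨j, Or.inl ⟨rfl, rfl⟩⟩
    · exact ⟨i, Or.inr ⟨rfl, rfl⟩⟩
    · refine absurd (eq_of_linked (W := {y i, y j}) hT (ha i) (ha j)
        (Linked.of_adj hab (by simp) (by simp)) ?_) hab.ne
      simp [(ha i).ne, (ha j).ne]
  · rintro ⟨i, ⟨rfl, rfl⟩ | ⟨rfl, rfl⟩⟩
    · exact ⟨ha i, Or.inl rfl, Or.inr ⟨i, rfl⟩⟩
    · exact ⟨(ha i).symm, Or.inr ⟨i, rfl⟩, Or.inl rfl⟩

/-- A star with three edges. -/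
theorem niceNum_star_three {v : V} {y : Fin 3 → V} (hy : Function.Injective y)
    (ha : ∀ i, T.Adj v (y i)) : NiceNum T (Set.range fun i => s(v, y i)) 4 := by
  refine ⟨System.ofDesign _ (star_injective hy ha)
    (![{0, 1}, {1, 2}, {0, 2}, {1, 2}] : Fin 4 → Finset (Fin 3)) ![true, true, false, false]
    (by decide) (fun i => isTrace_star hy ha (by revert i; decide)), System.size_ofDesign, ?_⟩
  rintro _ ⟨x, rfl⟩ b
  rw [System.has_ofDesign]
  revert x b
  decide

section growth

variable [DecidableEq V] {U : Finset V}

/-- In a tree of maximum degree at most three, one path per vertex and one more suffice. -/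
theorem niceNum_of_card_nbrs_le_three (hT : T.IsAcyclic) (hU : Conn T U) (hc : 2 ≤ U.card)
    (hdeg : ∀ x ∈ U, (nbrs T U x).card ≤ 3) : NiceNum T (edgesIn T U) (U.card + 1) := by
  obtain ⟨r, hr⟩ : U.Nonempty := Finset.card_pos.1 (by omega)
  obtain ⟨_, hr', t, ht, htr, hrt⟩ := exists_adj_of_ssubset hU (Finset.singleton_subset_iff.2 hr)
    (by simp) (by rintro rfl; simp at hc)
  rw [Finset.mem_singleton.1 hr'] at hrt
  have hne := hrt.ne
  have hφ : Function.Injective ![s(r, t)] := Function.injective_of_subsingleton _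
  -- Three copies of one edge: those of colour `true` are spare at `r` and `t` respectively, and the
  -- third is their common partner. Three paths on two vertices produce the surplus of one in the
  -- bound.
  let Q : System T (Set.range ![s(r, t)]) := System.ofDesign _ hφ
    (fun _ : Fin 3 => {0}) ![true, true, false] (by decide) (by
      intro i
      simpa using isTrace_singleton hrt)
  have hmem : ∀ e i, e = s(r, t) → e ∈ Q.path i := by
    rintro _ i rfl
    exact System.mem_ofDesign (x := 0) |>.2 (by simp)
  have hS : Conn T {r, t} := by
    refine Conn.of_center (v := r) fun x hx => ?_
    simp only [Finset.mem_insert, Finset.mem_singleton] at hx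
    rcases hx with rfl | rfl
    · exact Linked.refl (by simp)
    · exact Linked.of_adj hrt.symm (by simp) (by simp)
  have hxS : ∀ x, Active T U {r, t} x → x = r ∨ x = t := by
    rintro x ⟨hx, -⟩
    simpa using hx
  obtain ⟨J, hJr, hJt⟩ : ∃ J : V → Fin 3, J r = 0 ∧ J t = 1 :=
    ⟨fun x => if x = r then 0 else 1, by simp, by simp [hne.symm]⟩
  have hG : Growing T U {r, t} Q J (fun _ => (2 : Fin 3)) := by
    refine ⟨?_, ?_, ?_, ?_, ?_, ?_⟩
    · ext e
      induction e with | _ a b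
      simp only [Matrix.range_cons, Matrix.range_empty, Set.union_empty, Set.mem_singleton_iff,
        mk_mem_edgesIn, Finset.mem_insert, Finset.mem_singleton, Sym2.eq_iff]
      constructor
      · rintro (⟨rfl, rfl⟩ | ⟨rfl, rfl⟩)
        · exact ⟨hrt, by simp, by simp⟩
        · exact ⟨hrt.symm, by simp, by simp⟩
      · rintro ⟨hab, rfl | rfl, rfl | rfl⟩
        · exact absurd rfl hab.ne
        · simp
        · simp
        · exact absurd rfl hab.ne
    · rintro _ ⟨x, rfl⟩ b
      rw [System.has_ofDesign]
      revert x b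
      decide
    · intro x x' hx hx' h
      rcases hxS x hx with rfl | rfl <;> rcases hxS x' hx' with rfl | rfl
      · rfl
      · exact absurd (hJr.symm.trans (h.trans hJt)) (by decide)
      · exact absurd (hJt.symm.trans (h.trans hJr)) (by decide)
      · rfl
    · intro x hx
      change ![true, true, false] (J x) ≠ ![true, true, false] (2 : Fin 3)
      rcases hxS x hx with rfl | rfl
      · rw [hJr]
        decide
      · rw [hJt]
        decide
    · intro x hx
      rcases hxS x hx with rfl | rfl
      · refine ⟨t, by simp, hrt.symm, ?_, ?_⟩
        · intro w hw h
          simp only [Finset.mem_insert, Finset.mem_singleton] at hw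
          rcases hw with rfl | rfl
          exacts [absurd rfl h.ne, rfl]
        · exact ⟨hmem _ _ Sym2.eq_swap, hmem _ _ Sym2.eq_swap⟩
      · refine ⟨r, by simp, hrt, ?_, hmem _ _ rfl, hmem _ _ rfl⟩
        intro w hw h
        simp only [Finset.mem_insert, Finset.mem_singleton] at hw
        rcases hw with rfl | rfl
        exacts [rfl, absurd rfl h.ne]
    · rintro x hx _ ⟨z, rfl⟩
      change ∃ i : Fin 3, i ≠ J x ∧ ![true, true, false] i = ![true, true, false] (J x) ∧ _
      rcases hxS x hx with rfl | rfl
      · rw [hJr]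
        exact ⟨1, by decide, rfl, System.mem_ofDesign.2 (by simp [Subsingleton.elim z 0])⟩
      · rw [hJt]
        exact ⟨0, by decide, rfl, System.mem_ofDesign.2 (by simp [Subsingleton.elim z 0])⟩
  have hsub : ({r, t} : Finset V) ⊆ U := by
    simp [Finset.insert_subset_iff, hr, ht]
  have := hG.niceNum hT hU _ rfl hsub (by simp) hS fun x hx => Or.inr (hdeg x hx)
  have hsz : Q.size = 3 := System.size_ofDesign
  rw [hsz, Finset.card_sdiff_of_subset hsub, Finset.card_pair hne] at this
  rwa [show U.card + 1 = 3 + (U.card - 2) by omega]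

/-- The same bound if there is one vertex of degree four, two neighbours of which are leaves. -/
theorem niceNum_of_degree_four (hT : T.IsAcyclic) (hU : Conn T U) {v : V} (hv : v ∈ U)
    {y : Fin 4 → V} (hy : Function.Injective y) (hnb : nbrs T U v = Finset.univ.image y)
    (h₀ : nbrs T U (y 0) = {v}) (h₂ : nbrs T U (y 2) = {v})
    (hdeg : ∀ x ∈ U, x ≠ v → (nbrs T U x).card ≤ 3) :
    NiceNum T (edgesIn T U) (U.card + 1) := by
  have hyU : ∀ i, y i ∈ U ∧ T.Adj v (y i) := fun i => mem_nbrs.1 (by rw [hnb]; simp)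
  have ha := fun i => (hyU i).2
  let Q : System T (Set.range fun i => s(v, y i)) := System.ofDesign _ (star_injective hy ha)
    (![{0, 1}, {1, 2}, {2, 3}, {0, 2}, {1, 3}, {2, 3}] : Fin 6 → Finset (Fin 4))
    ![true, true, true, false, false, false]
    (by decide) (fun i => isTrace_star hy ha (by revert i; decide))
  set S : Finset V := insert v (Finset.univ.image y) with hSdef
  have hS : Conn T S := by
    refine Conn.of_center (v := v) fun x hx => ?_
    rcases Finset.mem_insert.1 hx with rfl | hx'
    · exact Linked.refl hx
    · obtain ⟨i, -, rfl⟩ := Finset.mem_image.1 hx'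
      exact Linked.of_adj (ha i).symm hx (by simp [S])
  have hxS : ∀ x, Active T U S x → x = y 1 ∨ x = y 3 := by
    rintro x ⟨hx, l, hl, hlS, hxl⟩
    have hl' : l ∈ nbrs T U x := mem_nbrs.2 ⟨hl, hxl⟩
    rcases Finset.mem_insert.1 hx with rfl | hx'
    · rw [hnb] at hl'
      exact absurd (Finset.mem_insert_of_mem hl') hlS
    · obtain ⟨i, -, rfl⟩ := Finset.mem_image.1 hx'
      have hlv : l ≠ v := by
        rintro rfl
        exact hlS (by simp [S])
      fin_cases i
      · exact absurd (by simpa [h₀] using hl') hlv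
      · exact Or.inl rfl
      · exact absurd (by simpa [h₂] using hl') hlv
      · exact Or.inr rfl
  have h31 : y 3 ≠ y 1 := hy.ne (by decide)
  have hleaf : ∀ i, ∀ w ∈ S, T.Adj w (y i) → w = v := by
    intro i w hw h
    rcases Finset.mem_insert.1 hw with rfl | hw'
    · rfl
    · exfalso
      obtain ⟨j, -, rfl⟩ := Finset.mem_image.1 hw'
      refine absurd (eq_of_linked (W := {y j, y i}) hT (ha j) (ha i)
        (Linked.of_adj h (by simp) (by simp)) ?_) h.ne
      simp [(ha i).ne, (ha j).ne]
  have hm : ∀ (x : Fin 4) (i : Fin 6), s(v, y x) ∈ Q.path i ↔ x ∈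
      (![{0, 1}, {1, 2}, {2, 3}, {0, 2}, {1, 3}, {2, 3}] : Fin 6 → Finset (Fin 4)) i :=
    fun x i => System.mem_ofDesign (x := x)
  -- Only `y 1` and `y 3` can still grow. Their spare paths have different colours, and without them
  -- `{0, 1}`, `{2, 3}` in `true` and `{0, 2}`, `{1, 3}` in `false` still cover the star. Six paths
  -- on five vertices again give surplus one.
  obtain ⟨J, hJ₁, hJ₃⟩ : ∃ J : V → Fin 6, J (y 1) = 1 ∧ J (y 3) = 5 :=
    ⟨fun x => if x = y 1 then 1 else 5, by simp, by simp [h31]⟩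
  obtain ⟨K, hK₁, hK₃⟩ : ∃ K : V → Fin 6, K (y 1) = 4 ∧ K (y 3) = 2 :=
    ⟨fun x => if x = y 1 then 4 else 2, by simp, by simp [h31]⟩
  have hG : Growing T U S Q J K := by
    refine ⟨(edgesIn_star hT ha).symm, ?_, ?_, ?_, ?_, ?_⟩
    · rintro _ ⟨x, rfl⟩ b
      rw [System.has_ofDesign]
      revert x b
      decide
    · intro x x' hx hx' h
      rcases hxS x hx with rfl | rfl <;> rcases hxS x' hx' with rfl | rfl
      · rfl
      · exact absurd (hJ₁.symm.trans (h.trans hJ₃)) (by decide)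
      · exact absurd (hJ₃.symm.trans (h.trans hJ₁)) (by decide)
      · rfl
    · intro x hx
      change ![true, true, true, false, false, false] (J x) ≠
        ![true, true, true, false, false, false] (K x)
      rcases hxS x hx with rfl | rfl
      · rw [hJ₁, hK₁]
        decide
      · rw [hJ₃, hK₃]
        decide
    · intro x hx
      refine ⟨v, by simp [S], ?_⟩
      rcases hxS x hx with rfl | rfl
      · exact ⟨ha 1, hleaf 1, (hm _ _).2 (by rw [hJ₁]; decide), (hm _ _).2 (by rw [hK₁]; decide)⟩
      · exact ⟨ha 3, hleaf 3, (hm _ _).2 (by rw [hJ₃]; decide), (hm _ _).2 (by rw [hK₃]; decide)⟩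
    · rintro x hx _ ⟨z, rfl⟩
      have key : ∀ j : Fin 6, j = 1 ∨ j = 5 → ∀ z : Fin 4, ∃ i ≠ j,
          (![true, true, true, false, false, false] : Fin 6 → Bool) i =
            (![true, true, true, false, false, false] : Fin 6 → Bool) j ∧ z ∈
          (![{0, 1}, {1, 2}, {2, 3}, {0, 2}, {1, 3}, {2, 3}] : Fin 6 → Finset (Fin 4)) i := by
        decide
      obtain ⟨i, h1, h2, h3⟩ := key (J x) (by
        rcases hxS x hx with rfl | rfl
        exacts [Or.inl hJ₁, Or.inr hJ₃]) z
      exact ⟨i, h1, h2, (hm _ _).2 h3⟩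
  have hsub : S ⊆ U := by
    refine Finset.insert_subset hv ?_
    rw [← hnb]
    exact fun x hx => (mem_nbrs.1 hx).1
  have hSc : S.card = 5 := by
    rw [hSdef, Finset.card_insert_of_notMem, Finset.card_image_of_injective _ hy, Finset.card_fin]
    intro h
    rw [← hnb, mem_nbrs] at h
    exact h.2.ne rfl
  have := hG.niceNum hT hU _ rfl hsub (by simp [S]) hS fun x hx => by
    by_cases hxv : x = v
    · left
      rw [hxv, hnb]
      exact Finset.subset_insert _ _
    · exact Or.inr (hdeg x hx hxv)
  have hsz : Q.size = 6 := System.size_ofDesign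
  have hle := Finset.card_le_card hsub
  rw [hsz, Finset.card_sdiff_of_subset hsub] at this
  rwa [show U.card + 1 = 6 + (U.card - S.card) by omega]

end growth

end

/-! ### Paths with at most five edges -/

section

variable {V : Type u} {T : SimpleGraph V}

theorem coverNum_singleton {u v : V} (h : T.Adj u v) : CoverNum T {s(u, v)} 1 := by
  refine ⟨⟨Unit, inferInstance, fun _ => {s(u, v)}, fun _ => true, fun _ => isTrace_singleton h,
    fun _ => subset_rfl, ?_⟩, rfl, ?_⟩
  · rintro e rfl f rfl h
    exact absurd rfl h
  · rintro e rfl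
    exact ⟨true, (), rfl, rfl⟩

theorem coverNum_pair {e f : Sym2 V} (he : e ∈ T.edgeSet) (hf : f ∈ T.edgeSet) (hef : e ≠ f) :
    CoverNum T {e, f} 2 := by
  have ht : ∀ {e : Sym2 V}, e ∈ T.edgeSet → IsTrace T {e} := by
    intro e
    induction e with | _ a b
    exact fun h => isTrace_singleton h
  refine ⟨⟨Bool, inferInstance, fun b => bif b then {e} else {f}, id, ?_, ?_, ?_⟩, rfl, ?_⟩
  · rintro (_ | _)
    exacts [ht hf, ht he]
  · rintro (_ | _)
    · exact fun x hx => Or.inr hx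
    · exact fun x hx => Or.inl hx
  · rintro x (rfl | rfl) y (rfl | rfl) hxy
    · exact absurd rfl hxy
    · exact ⟨true, false, by simp, ⟨rfl, hxy.symm⟩, rfl, hxy⟩
    · exact ⟨false, true, by simp, ⟨rfl, hxy.symm⟩, rfl, hxy⟩
    · exact absurd rfl hxy
  · rintro x (rfl | rfl)
    · exact ⟨true, true, rfl, rfl⟩
    · exact ⟨false, false, rfl, rfl⟩

section line

variable [DecidableEq V] {U : Finset V}

/-- The vertices `x 0, …, x n` trace a path of `T` in `U`, and are all the neighbours of each other. -/
structure IsLine (T : SimpleGraph V) (U : Finset V) (n : ℕ) (x : ℕ → V) : Prop where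
  inj : ∀ i ≤ n, ∀ j ≤ n, x i = x j → i = j
  adj : ∀ i < n, T.Adj (x i) (x (i + 1))
  mem : ∀ i ≤ n, x i ∈ U
  conn : Conn T ((Finset.range (n + 1)).image x)
  edges : edgesIn T ((Finset.range (n + 1)).image x) = {e | ∃ i < n, e = s(x i, x (i + 1))}

theorem IsLine.reverse {n : ℕ} {x : ℕ → V} (h : IsLine T U n x) :
    IsLine T U n fun i => x (n - i) := by
  have him : (Finset.range (n + 1)).image (fun i => x (n - i)) =
      (Finset.range (n + 1)).image x := by
    ext y
    simp only [Finset.mem_image, Finset.mem_range]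
    constructor
    · rintro ⟨i, hi, rfl⟩
      exact ⟨n - i, by omega, rfl⟩
    · rintro ⟨i, hi, rfl⟩
      exact ⟨n - i, by omega, by rw [show n - (n - i) = i by omega]⟩
  refine ⟨?_, ?_, fun i _ => h.mem _ (by omega), him ▸ h.conn, ?_⟩
  · intro i hi j hj hij
    have := h.inj _ (by omega) _ (by omega) hij
    omega
  · intro i hi
    have := (h.adj (n - (i + 1)) (by omega)).symm
    rwa [show n - (i + 1) + 1 = n - i by omega] at this
  · rw [him, h.edges]
    ext e
    simp only [Set.mem_ofPred_eq]
    constructor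
    · rintro ⟨i, hi, rfl⟩
      refine ⟨n - (i + 1), by omega, ?_⟩
      rw [show n - (n - (i + 1)) = i + 1 by omega, show n - (n - (i + 1) + 1) = i by omega]
      exact Sym2.eq_swap
    · rintro ⟨i, hi, rfl⟩
      refine ⟨n - (i + 1), by omega, ?_⟩
      rw [show n - (i + 1) + 1 = n - i by omega]
      exact Sym2.eq_swap

theorem IsLine.extend (hT : T.IsAcyclic) {n : ℕ} {x : ℕ → V} (h : IsLine T U n x) {l : V}
    (hl : l ∈ U) (hlx : l ∉ (Finset.range (n + 1)).image x) (ha : T.Adj (x n) l) :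
    ∃ x', IsLine T U (n + 1) x' := by
  have hx' : ∀ i ≤ n, Function.update x (n + 1) l i = x i := fun i hi =>
    Function.update_of_ne (by omega) _ _
  have hl' : Function.update x (n + 1) l (n + 1) = l := Function.update_self _ _ _
  have hne : ∀ i ≤ n, x i ≠ l := by
    rintro i hi rfl
    exact hlx (Finset.mem_image.2 ⟨i, by simp; omega, rfl⟩)
  have him : (Finset.range (n + 1 + 1)).image (Function.update x (n + 1) l) =
      insert l ((Finset.range (n + 1)).image x) := by
    rw [Finset.range_add_one, Finset.image_insert, hl']
    congr 1
    apply Finset.image_congr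
    intro i hi
    exact hx' i (by simp at hi; omega)
  have hxn : x n ∈ (Finset.range (n + 1)).image x := Finset.mem_image.2 ⟨n, by simp, rfl⟩
  refine ⟨Function.update x (n + 1) l, ?_, ?_, ?_, ?_, ?_⟩
  · intro i hi j hj hij
    rcases Nat.le_succ_iff.1 hi with hi | rfl <;> rcases Nat.le_succ_iff.1 hj with hj | rfl
    · rw [hx' i hi, hx' j hj] at hij
      exact h.inj i hi j hj hij
    · rw [hx' i hi, hl'] at hij
      exact absurd hij (hne i hi)
    · rw [hx' j hj, hl'] at hij
      exact absurd hij.symm (hne j hj)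
    · rfl
  · intro i hi
    rw [hx' i (by omega)]
    rcases Nat.lt_succ_iff_lt_or_eq.1 hi with hi | rfl
    · rw [hx' (i + 1) (by omega)]
      exact h.adj i hi
    · rwa [hl']
  · intro i hi
    rcases Nat.le_succ_iff.1 hi with hi | rfl
    · rw [hx' i hi]
      exact h.mem i hi
    · rwa [hl']
  · rw [him]
    exact h.conn.insert hxn ha
  · rw [him, edgesIn_insert hT h.conn hxn hlx ha, h.edges]
    ext e
    simp only [Set.mem_insert_iff, Set.mem_ofPred_eq]
    constructor
    · rintro (rfl | ⟨i, hi, rfl⟩)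
      · exact ⟨n, by omega, by rw [hx' n le_rfl, hl']⟩
      · exact ⟨i, by omega, by rw [hx' i (by omega), hx' (i + 1) (by omega)]⟩
    · rintro ⟨i, hi, rfl⟩
      rcases Nat.lt_succ_iff_lt_or_eq.1 hi with hi | rfl
      · exact Or.inr ⟨i, hi, by rw [hx' i (by omega), hx' (i + 1) (by omega)]⟩
      · exact Or.inl (by rw [hx' i le_rfl, hl'])

/-- An edge leaving the current path at an inner vertex would give that vertex a third neighbour, so
the path can be extended at an end, after reversal if it is the initial one. -/
theorem exists_isLine (hT : T.IsAcyclic) (hU : Conn T U) (hdeg : ∀ x ∈ U, (nbrs T U x).card ≤ 2) :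
    ∀ n, n < U.card → ∃ x, IsLine T U n x
  | 0, h => by
    obtain ⟨r, hr⟩ := Finset.card_pos.1 h
    have him : (Finset.range (0 + 1)).image (fun _ => r) = {r} := by simp
    refine ⟨fun _ => r, by intros; omega, by intros; omega, fun _ _ => hr, ?_, ?_⟩
    · rw [him]
      refine Conn.of_center (v := r) fun x hx => ?_
      rw [Finset.mem_singleton.1 hx]
      exact Linked.refl (by simp)
    · rw [him, edgesIn_singleton]
      ext e
      simp
  | n + 1, h => by
    obtain ⟨x, hx⟩ := exists_isLine hT hU hdeg n (by omega)
    have hc : ((Finset.range (n + 1)).image x).card ≤ n + 1 :=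
      Finset.card_image_le.trans (by simp)
    obtain ⟨v, hv, l, hlU, hl, hvl⟩ := exists_adj_of_ssubset hU
      (S := (Finset.range (n + 1)).image x) (by
        intro y hy
        obtain ⟨i, hi, rfl⟩ := Finset.mem_image.1 hy
        exact hx.mem i (by rw [Finset.mem_range] at hi; omega)) (by simp) (by
        intro h'
        rw [h'] at hc
        omega)
    obtain ⟨i, hi, rfl⟩ := Finset.mem_image.1 hv
    have hi : i ≤ n := by simp at hi; omega
    by_cases hin : i = n
    · subst hin
      exact hx.extend hT hlU hl hvl
    by_cases hi0 : i = 0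
    · subst hi0
      refine hx.reverse.extend hT hlU ?_ (by simpa using hvl)
      intro hl'
      apply hl
      obtain ⟨j, hj, rfl⟩ := Finset.mem_image.1 hl'
      exact Finset.mem_image.2 ⟨n - j, Finset.mem_range.2 (by omega), rfl⟩
    exfalso
    have hne : ∀ j ≤ n, x j ≠ l := by
      rintro j hj rfl
      exact hl (Finset.mem_image.2 ⟨j, by simp; omega, rfl⟩)
    have h1 : ({x (i - 1), x (i + 1), l} : Finset V) ⊆ nbrs T U (x i) := by
      intro y hy
      simp only [Finset.mem_insert, Finset.mem_singleton] at hy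
      rcases hy with rfl | rfl | rfl
      · refine mem_nbrs.2 ⟨hx.mem _ (by omega), ?_⟩
        have := hx.adj (i - 1) (by omega)
        rw [show i - 1 + 1 = i by omega] at this
        exact this.symm
      · exact mem_nbrs.2 ⟨hx.mem _ (by omega), hx.adj i (by omega)⟩
      · exact mem_nbrs.2 ⟨hlU, hvl⟩
    have h2 := (Finset.card_le_card h1).trans (hdeg _ (hx.mem i hi))
    rw [Finset.card_eq_three.2 ⟨_, _, _, ?_, hne _ (by omega), hne _ (by omega), rfl⟩] at h2
    · omega
    · intro h3
      have := hx.inj _ (by omega) _ (by omega) h3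
      omega

theorem IsLine.coverNum {m n : ℕ} {x : ℕ → V} (hx : IsLine T U m x) (D : Fin n → Finset (Fin m))
    (c : Fin n → Bool)
    (hD : ∀ x y, x ≠ y → ∃ i j, c i ≠ c j ∧ (x ∈ D i ∧ y ∉ D i) ∧ (y ∈ D j ∧ x ∉ D j))
    (hD' : ∀ k, (∃ i, D k = {i}) ∨ ∃ i j : Fin m, i.val + 1 = j.val ∧ D k = {i, j})
    (hc : ∀ x, ∃ i, x ∈ D i) : CoverNum T (edgesIn T ((Finset.range (m + 1)).image x)) n := by
  have hE : edgesIn T ((Finset.range (m + 1)).image x) =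
      Set.range fun i : Fin m => s(x i, x (i + 1)) := by
    rw [hx.edges]
    ext e
    constructor
    · rintro ⟨i, hi, rfl⟩
      exact ⟨⟨i, hi⟩, rfl⟩
    · rintro ⟨i, rfl⟩
      exact ⟨i, i.2, rfl⟩
  have hφ : Function.Injective fun i : Fin m => s(x i, x (i + 1)) := by
    intro i j hij
    have hi := i.2
    have hj := j.2
    rcases Sym2.eq_iff.1 hij with ⟨h, -⟩ | ⟨h, h'⟩
    · exact Fin.ext (hx.inj _ (by omega) _ (by omega) h)
    · have h1 := hx.inj _ (by omega) _ (by omega) h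
      have h2 := hx.inj _ (by omega) _ (by omega) h'
      omega
  rw [hE]
  refine ⟨System.ofDesign _ hφ D c hD ?_, System.size_ofDesign, ?_⟩
  · intro k
    rcases hD' k with ⟨i, hi⟩ | ⟨i, j, hij, hk⟩
    · rw [hi]
      simpa using isTrace_singleton (hx.adj i i.2)
    · have hj := j.2
      rw [hk]
      have := isTrace_pair (hx.adj i i.2).symm (hx.adj (i + 1) (by omega)) (fun h => by
          have := hx.inj i (by omega) (i + 1 + 1) (by omega) h
          omega)
      simpa [Set.image_pair, ← hij, Sym2.eq_swap (a := x (i + 1)) (b := x i)] using this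
  · rintro _ ⟨y, rfl⟩
    obtain ⟨i, hi⟩ := hc y
    exact ⟨c i, System.has_ofDesign.2 ⟨i, rfl, hi⟩⟩

/-- Paths with at most five edges. -/
theorem coverNum_of_card_nbrs_le_two (hT : T.IsAcyclic) (hU : Conn T U) (hne : U.Nonempty)
    (hdeg : ∀ x ∈ U, (nbrs T U x).card ≤ 2) (hc : U.card ≤ 6) :
    ∃ n, 3 * n + 4 ≤ 4 * U.card ∧ CoverNum T (edgesIn T U) n := by
  have hpos := hne.card_pos
  obtain ⟨x, hx⟩ := exists_isLine hT hU hdeg (U.card - 1) (by omega)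
  have hUx : (Finset.range (U.card - 1 + 1)).image x = U := by
    apply Finset.eq_of_subset_of_card_le
    · intro y hy
      obtain ⟨i, hi, rfl⟩ := Finset.mem_image.1 hy
      exact hx.mem i (by simp at hi; omega)
    · rw [Finset.card_image_of_injOn, Finset.card_range]
      · omega
      · intro i hi j hj hij
        simp at hi hj
        exact hx.inj i (by omega) j (by omega) hij
  rw [← hUx]
  obtain ⟨m, hm⟩ : ∃ m, U.card = m + 1 := ⟨U.card - 1, by omega⟩
  rw [hUx, hm]
  rw [← hUx]
  rw [hm, Nat.add_sub_cancel] at hx ⊢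
  have hm5 : m ≤ 5 := by omega
  clear hm hUx
  -- The designs use exactly ⌊4m/3⌋ paths for `m` edges; the budget is tight at `m = 3`.
  interval_cases m
  · exact ⟨0, by omega, hx.coverNum Fin.elim0 Fin.elim0 (by decide) (by decide) (by decide)⟩
  · exact ⟨1, by omega, hx.coverNum ![{0}] ![true] (by decide) (by decide) (by decide)⟩
  · exact ⟨2, by omega, hx.coverNum ![{0}, {1}] ![true, false] (by decide) (by decide) (by decide)⟩
  · exact ⟨4, by omega, hx.coverNum ![{0, 1}, {1, 2}, {0}, {2}] ![true, true, false, false]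
      (by decide) (by decide) (by decide)⟩
  · exact ⟨5, by omega, hx.coverNum ![{0, 1}, {1, 2}, {0}, {2, 3}, {3}]
      ![true, true, false, false, false] (by decide) (by decide) (by decide)⟩
  · exact ⟨6, by omega, hx.coverNum ![{0, 1}, {1, 2}, {4}, {0}, {2, 3}, {3, 4}]
      ![true, true, true, false, false, false] (by decide) (by decide) (by decide)⟩

end line

end

/-! ### Attaching a fork with five paths -/

section

variable {V : Type u} {T : SimpleGraph V}

/-- The edges at `v` of a fork: pendant edges `va`, `vb` and a pendant path `vcd`. -/
def forkEdge (v a b c d : V) : Fin 4 → Sym2 V := ![s(v, a), s(v, b), s(v, c), s(c, d)]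

theorem forkEdge_injective {v a b c d : V} (hvb : v ≠ b) (hvc : v ≠ c) (hvd : v ≠ d)
    (hab : a ≠ b) (hac : a ≠ c) (hbc : b ≠ c) :
    Function.Injective (forkEdge v a b c d) := by
  intro i j hij
  fin_cases i <;> fin_cases j <;> simp [forkEdge] at hij ⊢ <;> grind

/-- Attach a fork at a leaf `v` whose edge lies on a path that can be spared. -/
theorem CoverNum.fork_of_spare {H : Finset V} (Q : System T (edgesIn T H)) (hQ : Q.Covers)
    {v h a b c d : V} (hh : ∀ w ∈ H, T.Adj w v → w = h)
    (ha : T.Adj v a) (hb : T.Adj v b) (hc : T.Adj v c) (hd : T.Adj c d)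
    (hv : v ∈ H) (haH : a ∉ H) (hbH : b ∉ H) (hcH : c ∉ H) (hdH : d ∉ H)
    (hab : a ≠ b) (hac : a ≠ c) (hbc : b ≠ c) (had : a ≠ d)
    (P : Q.ι) (hP : s(h, v) ∈ Q.path P)
    (hsp : ∀ f ∈ edgesIn T H, Q.Has (!Q.color P) f ∨
      ∃ i ≠ P, Q.color i = Q.color P ∧ f ∈ Q.path i) :
    CoverNum T (edgesIn T H ∪ Set.range (forkEdge v a b c d)) (Q.size + 5) := by
  classical
  have hvd : v ≠ d := fun h => hdH (h ▸ hv)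
  have hφ := forkEdge_injective hb.ne hc.ne hvd hab hac hbc
  set φ := forkEdge v a b c d with hφdef
  let p := Q.color P
  -- Indices 0 to 3 stand for `va`, `vb`, `vc`, `cd`. These paths cover the fork in both colours;
  -- prolonging `P` by `va` is needed to separate `va` from `cd`.
  let D : Fin 5 → Finset (Fin 4) := ![{0, 2, 3}, {1, 2}, {0, 1}, {1, 2}, {3}]
  let col : Fin 5 → Bool := ![p, p, !p, !p, !p]
  have hm : ∀ x k, φ x ∈ φ '' (D k : Set (Fin 4)) ↔ x ∈ D k := fun x k => by
    rw [hφ.mem_set_image, Finset.mem_coe]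
  have hX : ∀ x i, (φ x ∈ if i = P then ({φ 0} : Set (Sym2 V)) else ∅) ↔ i = P ∧ x = 0 := by
    intro x i
    split_ifs with hi
    · simp [hi, hφ.eq_iff]
    · simp [hi]
  have hcases : ∀ t, t = p ∨ t = !p := by
    intro t
    cases t <;> cases p <;> simp
  have hnew : ∀ x t, ∃ k, col k = t ∧ x ∈ D k := by
    intro x t
    have : ∀ p t : Bool, ∀ x : Fin 4, ∃ k : Fin 5,
        (![p, p, !p, !p, !p] : Fin 5 → Bool) k = t ∧
        x ∈ (![{0, 2, 3}, {1, 2}, {0, 1}, {1, 2}, {3}] : Fin 5 → Finset (Fin 4)) k := by decide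
    exact this p t x
  obtain ⟨Q', α, β, hsize, -, -, -, -, -, hα, hβ⟩ :=
    Q.exists_extension (F := Set.range φ) (Fin 5) (fun i => if i = P then {φ 0} else ∅)
      (fun k => φ '' (D k : Set (Fin 4))) col (by
        rintro _ ⟨x, rfl⟩ hx
        fin_cases x
        · exact haH (hx.2 a (by simp [hφdef, forkEdge]))
        · exact hbH (hx.2 b (by simp [hφdef, forkEdge]))
        · exact hcH (hx.2 c (by simp [hφdef, forkEdge]))
        · exact hdH (hx.2 d (by simp [hφdef, forkEdge]))) (by
        intro i
        split_ifs
        · exact Set.singleton_subset_iff.2 ⟨0, rfl⟩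
        · exact Set.empty_subset _) (fun k => Set.image_subset_range _ _) (by
        intro i
        split_ifs with hi
        · rw [hi]
          exact isTrace_union_of_leaf Q hh hP haH ha
        · rw [Set.union_empty]
          exact Q.isTrace i) (by
        intro k
        fin_cases k
        · simpa [D, Set.image_insert_eq, hφdef, forkEdge] using
            isTrace_triple ha hc hd hac had hvd
        · simpa [D, Set.image_insert_eq, hφdef, forkEdge] using isTrace_pair hb hc hbc
        · simpa [D, Set.image_insert_eq, hφdef, forkEdge] using isTrace_pair ha hb hab
        · simpa [D, Set.image_insert_eq, hφdef, forkEdge] using isTrace_pair hb hc hbc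
        · simpa [D, hφdef, forkEdge] using isTrace_singleton hd) (by
        rintro _ ⟨x, rfl⟩ f hf
        simp only [hm, hX]
        -- Only `va` lies on an old path, namely `P`; for this edge alone the path through `f` must
        -- be chosen with care.
        by_cases hx : x = 0
        · rcases hsp f hf with ⟨i, hi, hfi⟩ | ⟨i, hi, hci, hfi⟩
          · refine ⟨p, hnew x p, i, hi, hfi, ?_⟩
            rintro ⟨rfl, -⟩
            simp at hi
          · exact ⟨!p, hnew x _, i, by simpa using hci, hfi, fun h => hi h.1⟩
        · obtain ⟨t, i, hi, hfi⟩ := hQ f hf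
          exact ⟨!t, hnew x _, i, by simpa using hi, hfi, fun h => hx h.2⟩) (by
        rintro _ ⟨x, rfl⟩ _ ⟨y, rfl⟩ hxy
        have key : ∀ p : Bool, ∀ x y : Fin 4, x ≠ y → ∃ i j : Option (Fin 5),
            (i.elim p (![p, p, !p, !p, !p] : Fin 5 → Bool)) ≠
              (j.elim p (![p, p, !p, !p, !p] : Fin 5 → Bool)) ∧
            (x ∈ i.elim {0} (![{0, 2, 3}, {1, 2}, {0, 1}, {1, 2}, {3}] : Fin 5 → Finset (Fin 4)) ∧
            y ∉ i.elim {0} (![{0, 2, 3}, {1, 2}, {0, 1}, {1, 2}, {3}] : Fin 5 → Finset (Fin 4))) ∧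
            (y ∈ j.elim {0} (![{0, 2, 3}, {1, 2}, {0, 1}, {1, 2}, {3}] : Fin 5 → Finset (Fin 4)) ∧
            x ∉ j.elim {0} (![{0, 2, 3}, {1, 2}, {0, 1}, {1, 2}, {3}] : Fin 5 → Finset (Fin 4))) := by
          decide
        obtain ⟨i, j, h1, h2, h3⟩ := key p x y (fun h => hxy (by rw [h]))
        let g : Option (Fin 5) → Q.ι ⊕ Fin 5 := fun i => i.elim (Sum.inl P) Sum.inr
        have hg1 : ∀ i, Sum.elim Q.color col (g i) = i.elim p col := by
          rintro (_ | i) <;> rfl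
        have hg2 : ∀ x i, φ x ∈ Sum.elim (fun i => if i = P then {φ 0} else ∅)
            (fun k => φ '' (D k : Set (Fin 4))) (g i) ↔ x ∈ i.elim {0} D := by
          rintro x (_ | i)
          · exact (hX x P).trans (by simp)
          · exact hm x i
        refine ⟨g i, g j, ?_, ?_⟩
        · rw [hg1, hg1]
          exact h1
        · rw [hg2, hg2, hg2, hg2]
          exact ⟨h2, h3⟩)
  refine ⟨Q', by simpa using hsize, ?_⟩
  rintro f (hf | ⟨x, rfl⟩)
  · obtain ⟨t, i, -, hi⟩ := hQ f hf
    exact ⟨_, α i, rfl, by rw [hα]; exact Or.inl hi⟩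
  · obtain ⟨k, -, hk⟩ := hnew x true
    exact ⟨_, β k, rfl, by rw [hβ]; exact (hm x k).2 hk⟩

/-- Attach a fork at a leaf `v` whose edge lies on one path only. -/
theorem CoverNum.fork_of_unique {E : Set (Sym2 V)} (Q : System T E)
    {v h a b c d : V} (hh : T.Adj v h)
    (ha : T.Adj v a) (hb : T.Adj v b) (hc : T.Adj v c) (hd : T.Adj c d)
    (hE : ∀ x, forkEdge v a b c d x ∉ E) (hvd : v ≠ d) (hhd : h ≠ d)
    (hab : a ≠ b) (hac : a ≠ c) (hbc : b ≠ c)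
    (P : Q.ι) (hP : s(v, h) ∈ Q.path P) (hu : ∀ i, s(v, h) ∈ Q.path i → i = P) :
    CoverNum T (E ∪ Set.range (forkEdge v a b c d)) (Q.size + 5) := by
  classical
  have hφ := forkEdge_injective hb.ne hc.ne hvd hab hac hbc
  have heE : s(v, h) ∈ E := Q.sub P hP
  set φ := forkEdge v a b c d with hφdef
  set e := s(v, h) with he
  -- Separating `e` from `f` has to use `P`, the only path through `e`. So `P` contains no other
  -- edge, and every other edge is covered in the opposite colour.
  have hsep : ∀ f ∈ E, f ≠ e → Q.Has (!Q.color P) f ∧ f ∉ Q.path P := by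
    intro f hf hfe
    obtain ⟨i, j, h1, ⟨h2, h3⟩, h4, h5⟩ := Q.sep e heE f hf hfe.symm
    obtain rfl := hu i h2
    exact ⟨⟨j, Bool.eq_not_of_ne h1.symm, h4⟩, h3⟩
  let Q₁ : System T (E \ {e}) :=
    { ι := {i // i ≠ P}
      fin := @Subtype.fintype _ _ _ Q.fin
      path := fun i => Q.path i
      color := fun i => Q.color i
      isTrace := fun i => Q.isTrace i
      sub := fun i f hf => ⟨Q.sub i hf, by
        rintro rfl
        exact i.2 (hu i hf)⟩
      sep := by
        rintro f ⟨hf, hfe⟩ g ⟨hg, hge⟩ hfg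
        obtain ⟨i, j, h1, h2, h3⟩ := Q.sep f hf g hg hfg
        refine ⟨⟨i, ?_⟩, ⟨j, ?_⟩, h1, h2, h3⟩
        · rintro rfl
          exact (hsep f hf hfe).2 h2.1
        · rintro rfl
          exact (hsep g hg hge).2 h3.1 }
  have hs₁ : Q₁.size + 1 = Q.size := by
    let := Q.fin
    have h1 : Q₁.size = Fintype.card Q.ι - 1 := Set.card_ne_eq P
    have h2 : 0 < Fintype.card Q.ι := Fintype.card_pos_iff.2 ⟨P⟩
    have h3 : Q.size = Fintype.card Q.ι := rfl
    omega
  have hh₁ : ∀ f ∈ E \ {e}, Q₁.Has (!Q.color P) f := by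
    rintro f ⟨hf, hfe⟩
    obtain ⟨i, hi, hfi⟩ := (hsep f hf hfe).1
    refine ⟨⟨i, ?_⟩, hi, hfi⟩
    rintro rfl
    simp at hi
  have hφ' : Function.Injective (Fin.cons e φ : Fin 5 → Sym2 V) := by
    rw [Fin.cons_injective_iff]
    refine ⟨?_, hφ⟩
    rintro ⟨x, hx⟩
    exact hE x (hx ▸ heE)
  let p := Q.color P
  have hne : ∀ x, φ x ≠ e := fun x hx => hE x (hx ▸ heE)
  have hha : h ≠ a := by
    rintro rfl
    exact hne 0 rfl
  have hhb : h ≠ b := by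
    rintro rfl
    exact hne 1 rfl
  have hhc : h ≠ c := by
    rintro rfl
    exact hne 2 rfl
  -- `P` is deleted and `e` joins the fork as index 0. Six paths covering these five edges in the
  -- colour of `P` are glued to the rest, which is covered in the other colour: a net increase of
  -- five.
  let Q₂ : System T (Set.range (Fin.cons e φ : Fin 5 → Sym2 V)) := System.ofDesign _ hφ'
    (![{0, 3, 4}, {1, 3}, {0, 2}, {1, 2}, {0, 1}, {4}] : Fin 6 → Finset (Fin 5))
    ![p, p, p, !p, !p, !p] (by
      have : ∀ p : Bool, ∀ x y : Fin 5, x ≠ y → ∃ i j : Fin 6,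
          (![p, p, p, !p, !p, !p] : Fin 6 → Bool) i ≠ (![p, p, p, !p, !p, !p] : Fin 6 → Bool) j ∧
          (x ∈ (![{0, 3, 4}, {1, 3}, {0, 2}, {1, 2}, {0, 1}, {4}] : Fin 6 → Finset (Fin 5)) i ∧
          y ∉ (![{0, 3, 4}, {1, 3}, {0, 2}, {1, 2}, {0, 1}, {4}] : Fin 6 → Finset (Fin 5)) i) ∧
          (y ∈ (![{0, 3, 4}, {1, 3}, {0, 2}, {1, 2}, {0, 1}, {4}] : Fin 6 → Finset (Fin 5)) j ∧
          x ∉ (![{0, 3, 4}, {1, 3}, {0, 2}, {1, 2}, {0, 1}, {4}] : Fin 6 → Finset (Fin 5)) j) := by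
        decide
      exact this p) (by
      have h0 : (Fin.cons e φ : Fin 5 → Sym2 V) 0 = s(v, h) := rfl
      have h1 : (Fin.cons e φ : Fin 5 → Sym2 V) 1 = s(v, a) := rfl
      have h2 : (Fin.cons e φ : Fin 5 → Sym2 V) 2 = s(v, b) := rfl
      have h3 : (Fin.cons e φ : Fin 5 → Sym2 V) 3 = s(v, c) := rfl
      have h4 : (Fin.cons e φ : Fin 5 → Sym2 V) 4 = s(c, d) := rfl
      intro k
      fin_cases k
      · simpa [Set.image_insert_eq, h0, h3, h4] using isTrace_triple hh hc hd hhc hhd hvd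
      · simpa [Set.image_insert_eq, h1, h3] using isTrace_pair ha hc hac
      · simpa [Set.image_insert_eq, h0, h2] using isTrace_pair hh hb hhb
      · simpa [Set.image_insert_eq, h1, h2] using isTrace_pair ha hb hab
      · simpa [Set.image_insert_eq, h0, h1] using isTrace_pair hh ha hha
      · simpa [h4] using isTrace_singleton hd)
  have hh₂ : ∀ f ∈ Set.range (Fin.cons e φ : Fin 5 → Sym2 V), Q₂.Has (!!p) f := by
    rintro _ ⟨x, rfl⟩
    rw [Bool.not_not, System.has_ofDesign]
    have : ∀ p : Bool, ∀ x : Fin 5, ∃ i : Fin 6,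
        (![p, p, p, !p, !p, !p] : Fin 6 → Bool) i = p ∧
        x ∈ (![{0, 3, 4}, {1, 3}, {0, 2}, {1, 2}, {0, 1}, {4}] : Fin 6 → Finset (Fin 5)) i := by
      decide
    exact this p x
  have hs₂ : Q₂.size = 6 := System.size_ofDesign
  have := CoverNum.union_half Q₁ Q₂ hh₁ hh₂ (by
    rintro f ⟨hf, hfe⟩ ⟨x, rfl⟩
    rcases Fin.eq_zero_or_eq_succ x with rfl | ⟨x, rfl⟩
    · exact hfe rfl
    · exact hE x hf)
  rw [show Q.size + 5 = Q₁.size + Q₂.size by omega]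
  convert this using 1
  rw [Fin.range_cons]
  ext f
  simp only [Set.mem_union, Set.mem_insert_iff, Set.mem_sdiff, Set.mem_singleton_iff]
  by_cases hf : f = e
  · simp [hf, heE]
  · simp [hf]

/-- Attach a fork at a leaf `v`. -/
theorem CoverNum.fork {H : Finset V} {n : ℕ} (hn : CoverNum T (edgesIn T H) n)
    {v h a b c d : V} (hv : v ∈ H) (hhH : h ∈ H) (hvh : T.Adj v h)
    (hh : ∀ w ∈ H, T.Adj w v → w = h)
    (ha : T.Adj v a) (hb : T.Adj v b) (hc : T.Adj v c) (hd : T.Adj c d)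
    (haH : a ∉ H) (hbH : b ∉ H) (hcH : c ∉ H) (hdH : d ∉ H)
    (hab : a ≠ b) (hac : a ≠ c) (hbc : b ≠ c) (had : a ≠ d) :
    CoverNum T (edgesIn T H ∪ Set.range (forkEdge v a b c d)) (n + 5) := by
  obtain ⟨Q, rfl, hQ⟩ := hn
  have heE : s(v, h) ∈ edgesIn T H := mk_mem_edgesIn.2 ⟨hvh, hv, hhH⟩
  obtain ⟨-, P, -, hP⟩ := hQ _ heE
  by_cases hu : ∀ i, s(v, h) ∈ Q.path i → i = P
  · refine CoverNum.fork_of_unique Q hvh ha hb hc hd ?_ (fun h => hdH (h ▸ hv))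
      (fun h => hdH (h ▸ hhH)) hab hac hbc P hP hu
    intro x hx
    fin_cases x
    · exact haH (hx.2 a (by simp [forkEdge]))
    · exact hbH (hx.2 b (by simp [forkEdge]))
    · exact hcH (hx.2 c (by simp [forkEdge]))
    · exact hdH (hx.2 d (by simp [forkEdge]))
  -- With a second path through `vh`, `P` can be spared: that path stands in for `P` on `vh`, and
  -- every other edge lies on a path avoiding `vh`, hence different from `P`.
  · push Not at hu
    obtain ⟨i₀, hi₀, hi₀P⟩ := hu
    refine CoverNum.fork_of_spare Q hQ hh ha hb hc hd hv haH hbH hcH hdH hab hac hbc had P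
      (by rwa [Sym2.eq_swap]) ?_
    intro f hf
    by_cases hfe : f = s(v, h)
    · subst hfe
      by_cases hc : Q.color i₀ = Q.color P
      · exact Or.inr ⟨i₀, hi₀P, hc, hi₀⟩
      · exact Or.inl ⟨i₀, Bool.eq_not_of_ne hc, hi₀⟩
    · obtain ⟨i, j, h1, ⟨h2, h3⟩, h4, h5⟩ := Q.sep _ heE f hf (Ne.symm hfe)
      by_cases hc : Q.color j = Q.color P
      · exact Or.inr ⟨j, fun h => h5 (h ▸ hP), hc, h4⟩
      · exact Or.inl ⟨j, Bool.eq_not_of_ne hc, h4⟩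

end

/-! ### Budgets, unions of branches and the extremal vertex -/

section

variable {V : Type u} {T : SimpleGraph V} [DecidableEq V] {U : Finset V} {v h x : V} {s : Finset V}

/-- `U` satisfies the bound of the theorem. -/
def Bounded (T : SimpleGraph V) (U : Finset V) : Prop :=
  ∃ n, 3 * n + 4 ≤ 4 * U.card ∧ CoverNum T (edgesIn T U) n

theorem Branching.bounded {A : Finset V} {n : ℕ} (hA : Branching T U v A) (hv : v ∈ U)
    (h₁ : Bounded T (U \ A)) (h₂ : NiceNum T (edgesIn T (insert v A)) n)
    (hn : 3 * n ≤ 4 * A.card) : Bounded T U := by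
  obtain ⟨m, hm, hc⟩ := h₁
  refine ⟨m + n, ?_, hA.coverNum hv hc h₂⟩
  have := Finset.card_sdiff_add_card_eq_card hA.sub
  omega

/-- The union of the branches at `v` through the vertices of `s`. -/
noncomputable def branches (T : SimpleGraph V) (U : Finset V) (v : V) (s : Finset V) : Finset V :=
  s.biUnion (branch T U v)

theorem mem_branches : x ∈ branches T U v s ↔ ∃ c ∈ s, x ∈ branch T U v c := by
  simp [branches]

theorem branching_branches : Branching T U v (branches T U v s) where
  sub x hx := by
    obtain ⟨c, -, hc⟩ := mem_branches.1 hx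
    exact branching_branch.sub hc
  not_mem h := by
    obtain ⟨c, -, hc⟩ := mem_branches.1 h
    exact branching_branch.not_mem hc
  closed x hx y hy hyv h := by
    obtain ⟨c, hc, hxc⟩ := mem_branches.1 hx
    exact mem_branches.2 ⟨c, hc, branching_branch.closed x hxc y hy hyv h⟩

theorem subset_branches (hs : s ⊆ nbrs T U v) : s ⊆ branches T U v s := fun c hc =>
  mem_branches.2 ⟨c, hc, self_mem_branch (mem_nbrs.1 (hs hc)).1 (mem_nbrs.1 (hs hc)).2.ne.symm⟩

theorem nbrs_insert_branches (hT : T.IsAcyclic) (hs : s ⊆ nbrs T U v) :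
    nbrs T (insert v (branches T U v s)) v = s := by
  ext y
  rw [mem_nbrs, Finset.mem_insert]
  constructor
  · rintro ⟨rfl | hy, h⟩
    · exact absurd rfl h.ne
    · obtain ⟨c, hc, hyc⟩ := mem_branches.1 hy
      rwa [eq_of_mem_branch hT (mem_nbrs.1 (hs hc)).2 h hyc]
  · intro hy
    exact ⟨Or.inr (subset_branches hs hy), (mem_nbrs.1 (hs hy)).2⟩

theorem card_branches (hT : T.IsAcyclic) (hs : s ⊆ nbrs T U v) :
    (branches T U v s).card = ∑ c ∈ s, (branch T U v c).card :=
  Finset.card_biUnion fun _ ha _ hb hab =>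
    disjoint_branch hT (mem_nbrs.1 (hs ha)).2 (mem_nbrs.1 (hs hb)).2 hab

theorem one_le_card_branch (hx : x ∈ nbrs T U v) : 1 ≤ (branch T U v x).card :=
  Finset.card_pos.2 ⟨x, self_mem_branch (mem_nbrs.1 hx).1 (mem_nbrs.1 hx).2.ne.symm⟩

theorem exists_of_not_leaf (hv : v ∈ U) (hx : x ∈ nbrs T U v) (hl : nbrs T U x ≠ {v}) :
    ∃ d ∈ branch T U v x, T.Adj x d := by
  have hx' := mem_nbrs.1 hx
  by_contra! hd
  apply hl
  ext y
  rw [mem_nbrs, Finset.mem_singleton]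
  constructor
  · rintro ⟨hy, hxy⟩
    by_contra hyv
    exact hd y (branching_branch.closed x (self_mem_branch hx'.1 hx'.2.ne.symm) y hy hyv hxy) hxy
  · rintro rfl
    exact ⟨hv, hx'.2.symm⟩

theorem two_le_card_branch (hv : v ∈ U) (hx : x ∈ nbrs T U v) (hl : nbrs T U x ≠ {v}) :
    2 ≤ (branch T U v x).card := by
  obtain ⟨d, hd, hxd⟩ := exists_of_not_leaf hv hx hl
  have hx' := mem_nbrs.1 hx
  rw [← Finset.card_pair hxd.ne]
  apply Finset.card_le_card
  simp [Finset.insert_subset_iff, hd, self_mem_branch hx'.1 hx'.2.ne.symm]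

theorem branching_of_leaves {ι : Type*} [Fintype ι] {y : ι → V} (hyv : ∀ i, y i ∈ nbrs T U v)
    (hl : ∀ i, nbrs T U (y i) = {v}) : Branching T U v (Finset.univ.image y) := by
  refine ⟨?_, ?_, ?_⟩
  · intro x hx
    obtain ⟨i, -, rfl⟩ := Finset.mem_image.1 hx
    exact (mem_nbrs.1 (hyv i)).1
  · intro hx
    obtain ⟨i, -, hi⟩ := Finset.mem_image.1 hx
    exact (mem_nbrs.1 (hyv i)).2.ne hi.symm
  · intro x hx z hz hzv hxz
    obtain ⟨i, -, rfl⟩ := Finset.mem_image.1 hx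
    have : z ∈ nbrs T U (y i) := mem_nbrs.2 ⟨hz, hxz⟩
    rw [hl, Finset.mem_singleton] at this
    exact absurd this hzv

/-- Three leaves at the same vertex can be removed. -/
theorem bounded_of_three_leaves (hT : T.IsAcyclic) (hv : v ∈ U) {y : Fin 3 → V}
    (hy : Function.Injective y) (hyv : ∀ i, y i ∈ nbrs T U v) (hl : ∀ i, nbrs T U (y i) = {v})
    (ih : Bounded T (U \ Finset.univ.image y)) : Bounded T U := by
  have hA := branching_of_leaves hyv hl
  have ha : ∀ i, T.Adj v (y i) := fun i => (mem_nbrs.1 (hyv i)).2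
  refine hA.bounded (n := 4) hv ih ?_ ?_
  · rw [edgesIn_star hT ha]
    exact niceNum_star_three hy ha
  · rw [Finset.card_image_of_injective _ hy]
    simp

/-- Small trees with a vertex of degree three. -/
theorem bounded_of_degree_three (hT : T.IsAcyclic) (hU : Conn T U) (hv : v ∈ U)
    (hd : (nbrs T U v).card = 3) (hc : U.card ≤ 6) : Bounded T U := by
  obtain ⟨a, b, c, hab, hac, hbc, habc⟩ := Finset.card_eq_three.1 hd
  have hy : Function.Injective ![a, b, c] := by
    intro i j hij
    fin_cases i <;> fin_cases j <;> simp at hij ⊢ <;> grind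
  have him : Finset.univ.image ![a, b, c] = nbrs T U v := by
    rw [habc]
    ext
    simp [Fin.exists_fin_succ, eq_comm]
  have ha : ∀ i, T.Adj v (![a, b, c] i) := fun i => by
    have : ![a, b, c] i ∈ nbrs T U v := by
      rw [← him]
      simp
    exact (mem_nbrs.1 this).2
  have hstar := niceNum_star_three hy ha
  rw [← edgesIn_star hT ha, him] at hstar
  set S := insert v (nbrs T U v) with hSdef
  have hvn : v ∉ nbrs T U v := fun h => (mem_nbrs.1 h).2.ne rfl
  have hSU : S ⊆ U := Finset.insert_subset hv fun x hx => (mem_nbrs.1 hx).1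
  have hSc : S.card = 4 := by rw [hSdef, Finset.card_insert_of_notMem hvn, hd]
  have hS : Conn T S := by
    refine Conn.of_center (v := v) fun x hx => ?_
    rcases Finset.mem_insert.1 hx with rfl | hx'
    · exact Linked.refl hx
    · exact Linked.of_adj (mem_nbrs.1 hx').2.symm hx (by simp [S])
  -- At most two edges lie outside the star at `v`. Each gets its own single-edge path, which is
  -- enough because the star is covered in both colours.
  by_cases hSU' : S = U
  · rw [hSU'] at hstar hSc
    exact ⟨4, by omega, hstar.coverNum⟩
  obtain ⟨w, hw, l, hlU, hl, hwl⟩ := exists_adj_of_ssubset hU hSU (by simp [S]) hSU'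
  have hE := edgesIn_insert hT hS hw hl hwl
  have hc' : (insert l S).card = 5 := by rw [Finset.card_insert_of_notMem hl, hSc]
  have hS'U : insert l S ⊆ U := Finset.insert_subset hlU hSU
  have hnS : s(w, l) ∉ edgesIn T S := fun h => hl (h.2 l (by simp))
  by_cases hS'e : insert l S = U
  · have := (coverNum_singleton hwl).union hstar (by
      rintro e rfl
      exact hnS)
    rw [Set.singleton_union, ← hE, hS'e] at this
    rw [hS'e] at hc'
    exact ⟨_, by omega, this⟩
  have hS' := hS.insert hw hwl
  obtain ⟨w', hw', l', hlU', hl', hwl'⟩ := exists_adj_of_ssubset hU hS'U (by simp) hS'e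
  have hE' := edgesIn_insert hT hS' hw' hl' hwl'
  have hc'' : (insert l' (insert l S)).card = 6 := by rw [Finset.card_insert_of_notMem hl', hc']
  have hS''U : insert l' (insert l S) = U :=
    Finset.eq_of_subset_of_card_le (Finset.insert_subset hlU' hS'U) (by omega)
  have hn' : s(w', l') ∉ edgesIn T (insert l S) := fun h => hl' (h.2 l' (by simp))
  have hn'S : s(w', l') ∉ edgesIn T S := fun h =>
    hn' (edgesIn_mono (Finset.subset_insert _ _) h)
  have hne : s(w', l') ≠ s(w, l) := by
    intro h
    apply hn'
    rw [h, hE]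
    exact Or.inl rfl
  have := (coverNum_pair (T := T) hwl' hwl hne).union hstar (by
    rintro e (rfl | rfl)
    exacts [hn'S, hnS])
  rw [Set.insert_union, Set.singleton_union, ← hE, ← hE', hS''U] at this
  rw [hS''U] at hc''
  exact ⟨_, by omega, this⟩

/-- There are a vertex `v` of degree at least four and a neighbour `h` such that all vertices outside
the branch through `h` have degree at most three. -/
theorem exists_extremal (hU : Conn T U) (hbig : ∃ v ∈ U, 4 ≤ (nbrs T U v).card) :
    ∃ v ∈ U, 4 ≤ (nbrs T U v).card ∧ ∃ h ∈ nbrs T U v, ∀ x ∈ U, x ≠ v → x ∉ branch T U v h →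
      (nbrs T U x).card ≤ 3 := by
  classical
  obtain ⟨v₀, hv₀, hd₀⟩ := hbig
  obtain ⟨h₀, hh₀⟩ : (nbrs T U v₀).Nonempty := Finset.card_pos.1 (by omega)
  -- The part outside the branch through `h` is minimised. An offending `x`, with its neighbour `h'`
  -- towards `v`, would have a branch containing the old one and `v` as well.
  obtain ⟨⟨v, h⟩, hvh, hmin⟩ := Finset.exists_min_image
    ((U ×ˢ U).filter fun p => 4 ≤ (nbrs T U p.1).card ∧ p.2 ∈ nbrs T U p.1)
    (fun p => (U \ branch T U p.1 p.2).card)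
    ⟨(v₀, h₀), by simp [hv₀, hd₀, (mem_nbrs.1 hh₀).1, (mem_nbrs.1 hh₀).2]⟩
  rw [Finset.mem_filter, Finset.mem_product] at hvh
  obtain ⟨⟨hv, hh⟩, hd, hhv⟩ := hvh
  refine ⟨v, hv, hd, h, hhv, fun x hx hxv hxb => ?_⟩
  by_contra hdx
  obtain ⟨h', hh', hvb⟩ := exists_mem_branch hU hx hv hxv.symm
  have hle := hmin (x, h') (by
    simp only [Finset.mem_filter, Finset.mem_product]
    exact ⟨⟨hx, (mem_nbrs.1 hh').1⟩, by omega, hh'⟩)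
  refine absurd hle (not_le.2 (Finset.card_lt_card ?_))
  have hadj := (mem_nbrs.1 hhv).2
  have hsub : branch T U v h ⊆ branch T U x h' := by
    intro y hy
    obtain ⟨p, hp⟩ := mem_branch.1 hy
    have hhx : h ≠ x := by
      rintro rfl
      exact hxb (self_mem_branch hh hadj.ne.symm)
    refine mem_branch.2 (((mem_branch.1 hvb).trans
      (Linked.of_adj hadj (by simp [hv, hxv.symm]) (by simp [hh, hhx]))).trans ⟨p, fun z hz => ?_⟩)
    rw [Finset.mem_erase]
    refine ⟨?_, Finset.mem_of_mem_erase (hp z hz)⟩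
    rintro rfl
    exact hxb (mem_branch.2 ⟨p.takeUntil z hz, fun w hw =>
      hp w (p.support_takeUntil_subset_support hz hw)⟩)
  rw [Finset.ssubset_iff_of_subset (Finset.sdiff_subset_sdiff subset_rfl hsub)]
  exact ⟨v, by simp [hv, branching_branch.not_mem], by simp [hvb]⟩

end

/-! ### Reductions that remove branches -/

section

variable {V : Type u} {T : SimpleGraph V}

theorem injective_four {a b c d : V} (hab : a ≠ b) (hac : a ≠ c) (had : a ≠ d) (hbc : b ≠ c)
    (hbd : b ≠ d) (hcd : c ≠ d) : Function.Injective ![a, b, c, d] := by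
  intro i j hij
  fin_cases i <;> fin_cases j <;> simp at hij ⊢ <;> grind

theorem insert_four {α : Type*} (E : Set α) (e₁ e₂ e₃ e₄ : α) :
    insert e₄ (insert e₃ (insert e₂ (insert e₁ E))) = E ∪ {e₁, e₂, e₃, e₄} := by
  ext
  simp only [Set.mem_insert_iff, Set.mem_union, Set.mem_singleton_iff]
  tauto

theorem image_four [DecidableEq V] (a b c d : V) : Finset.univ.image ![a, b, c, d] = {a, b, c, d} := by
  ext
  simp [Fin.exists_fin_succ, eq_comm]

variable [DecidableEq V] {U : Finset V} {v h x : V} {s : Finset V}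

theorem card_nbrs_insert_branches_le (hv : v ∈ U) (hx : x ∈ branches T U v s) :
    (nbrs T (insert v (branches T U v s)) x).card ≤ (nbrs T U x).card := by
  rw [branching_branches.nbrs_eq hx hv]

/-- Remove three branches that are not single edges. -/
theorem bounded_of_three_branches (hT : T.IsAcyclic) (hU : Conn T U) (hv : v ∈ U)
    (hs : s ⊆ nbrs T U v) (hc : s.card = 3) (hl : ∀ c ∈ s, nbrs T U c ≠ {v})
    (hdeg : ∀ x ∈ branches T U v s, (nbrs T U x).card ≤ 3)
    (ih : Bounded T (U \ branches T U v s)) : Bounded T U := by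
  have hA := branching_branches (T := T) (U := U) (v := v) (s := s)
  have hcard : 6 ≤ (branches T U v s).card := by
    rw [card_branches hT hs]
    have := Finset.card_nsmul_le_sum s _ 2 fun c hc => two_le_card_branch hv (hs hc) (hl c hc)
    rw [hc] at this
    simpa using this
  have hW : (insert v (branches T U v s)).card = (branches T U v s).card + 1 :=
    Finset.card_insert_of_notMem hA.not_mem
  -- The inequality 3(|A| + 2) ≤ 4|A| is where six vertices are needed.
  refine hA.bounded (n := (branches T U v s).card + 2) hv ih ?_ (by omega)
  have := niceNum_of_card_nbrs_le_three hT (hA.conn_insert hU hv) (by omega) (by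
    intro x hx
    rcases Finset.mem_insert.1 hx with rfl | hx
    · rw [nbrs_insert_branches hT hs, hc]
    · exact (card_nbrs_insert_branches_le hv hx).trans (hdeg x hx))
  rwa [hW] at this

/-- Remove four branches, two of which are single edges. -/
theorem bounded_of_four_branches (hT : T.IsAcyclic) (hU : Conn T U) (hv : v ∈ U)
    {y : Fin 4 → V} (hy : Function.Injective y) (hs : Finset.univ.image y ⊆ nbrs T U v)
    (h₀ : nbrs T U (y 0) = {v}) (h₁ : nbrs T U (y 1) ≠ {v})
    (h₂ : nbrs T U (y 2) = {v}) (h₃ : nbrs T U (y 3) ≠ {v})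
    (hdeg : ∀ x ∈ branches T U v (Finset.univ.image y), (nbrs T U x).card ≤ 3)
    (ih : Bounded T (U \ branches T U v (Finset.univ.image y))) : Bounded T U := by
  set s := Finset.univ.image y
  have hA := branching_branches (T := T) (U := U) (v := v) (s := s)
  have hys : ∀ i, y i ∈ s := fun i => Finset.mem_image_of_mem _ (Finset.mem_univ _)
  have hcard : 6 ≤ (branches T U v s).card := by
    rw [card_branches hT hs, Finset.sum_image fun _ _ _ _ h => hy h]
    have e0 := one_le_card_branch (hs (hys 0))
    have e1 := two_le_card_branch hv (hs (hys 1)) h₁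
    have e2 := one_le_card_branch (hs (hys 2))
    have e3 := two_le_card_branch hv (hs (hys 3)) h₃
    rw [Fin.sum_univ_four]
    omega
  have hW : (insert v (branches T U v s)).card = (branches T U v s).card + 1 :=
    Finset.card_insert_of_notMem hA.not_mem
  refine hA.bounded (n := (branches T U v s).card + 2) hv ih ?_ (by omega)
  have := niceNum_of_degree_four hT (hA.conn_insert hU hv) (Finset.mem_insert_self _ _) hy
    (nbrs_insert_branches hT hs)
    (by rw [hA.nbrs_eq (subset_branches hs (hys 0)) hv, h₀])
    (by rw [hA.nbrs_eq (subset_branches hs (hys 2)) hv, h₂]) (by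
    intro x hx hxv
    have hx := Finset.mem_of_mem_insert_of_ne hx hxv
    exact (card_nbrs_insert_branches_le hv hx).trans (hdeg x hx))
  rwa [hW] at this

section last

variable {a c : V}

theorem not_mem_branches_erase (hT : T.IsAcyclic) (hh : h ∈ nbrs T U v)
    (hC : (nbrs T U v).erase h = s) : h ∉ branches T U v s := by
  intro hm
  obtain ⟨b, hb, hhb⟩ := mem_branches.1 hm
  rw [← hC, Finset.mem_erase] at hb
  exact hb.1 (eq_of_mem_branch hT (mem_nbrs.1 hb.2).2 (mem_nbrs.1 hh).2 hhb).symm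

/-- Every neighbour of `v` except `h` belongs to `s`, so `v` with these branches can be left only
through `h`. -/
theorem branching_insert_branches (hT : T.IsAcyclic) (hh : h ∈ nbrs T U v)
    (hC : (nbrs T U v).erase h = s) (hv : v ∈ U) :
    Branching T U h (insert v (branches T U v s)) := by
  have hA := branching_branches (T := T) (U := U) (v := v) (s := s)
  have hs : s ⊆ nbrs T U v := hC ▸ Finset.erase_subset _ _
  have hhA := not_mem_branches_erase hT hh hC
  obtain ⟨hhU, hvh⟩ := mem_nbrs.1 hh
  set A := branches T U v s with hAdef
  refine ⟨Finset.insert_subset hv hA.sub, ?_, ?_⟩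
  · simp only [Finset.mem_insert, not_or]
    exact ⟨hvh.ne.symm, hhA⟩
  · intro y hy z hz hzh hyz
    rcases Finset.mem_insert.1 hy with rfl | hy
    · refine Finset.mem_insert_of_mem (subset_branches hs ?_)
      rw [← hC]
      exact Finset.mem_erase.2 ⟨hzh, mem_nbrs.2 ⟨hz, hyz⟩⟩
    · by_cases hzv : z = v
      · simp [hzv]
      · exact Finset.mem_insert_of_mem (hA.closed y hy z hz hzv hyz)

/-- Remove all branches at `v` but the one through `h`, together with the edge `vh`. -/
theorem bounded_of_cut (hT : T.IsAcyclic) (hh : h ∈ nbrs T U v)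
    (hC : (nbrs T U v).erase h = {x, a, c})
    (hU : Conn T U) (hv : v ∈ U) (hxa : x ≠ a) (hxc : x ≠ c) (hac : a ≠ c)
    (hx : nbrs T U x = {v}) (hcard : 5 ≤ (branches T U v {x, a, c}).card)
    (hdeg : ∀ y ∈ branches T U v {x, a, c}, (nbrs T U y).card ≤ 3)
    (ih : Bounded T (U \ insert v (branches T U v {x, a, c}))) : Bounded T U := by
  have hA := branching_branches (T := T) (U := U) (v := v) (s := {x, a, c})
  have hs : ({x, a, c} : Finset V) ⊆ nbrs T U v := hC ▸ Finset.erase_subset _ _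
  have hhA := not_mem_branches_erase hT hh hC
  obtain ⟨hhU, hvh⟩ := mem_nbrs.1 hh
  set A := branches T U v {x, a, c} with hAdef
  have hch : ∀ y ∈ ({x, a, c} : Finset V), y ≠ h := by
    rw [← hC]
    exact fun y hy => Finset.ne_of_mem_erase hy
  have hnb : nbrs T U v = insert h {x, a, c} := by
    rw [← hC, Finset.insert_erase hh]
  have hB : Branching T U h (insert v A) := branching_insert_branches hT hh hC hv
  have hcA : (insert v A).card = A.card + 1 := Finset.card_insert_of_notMem hA.not_mem
  have hcB : (insert h (insert v A)).card = A.card + 2 := by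
    rw [Finset.card_insert_of_notMem hB.not_mem, hcA]
  -- Cutting at `h` removes |A| + 1 vertices at a cost of |A| + 3 paths, so |A| ≥ 5 suffices.
  refine hB.bounded (n := A.card + 3) hhU ih ?_ (by omega)
  have hWU : insert h (insert v A) ⊆ U := Finset.insert_subset hhU hB.sub
  have hvW : v ∈ insert h (insert v A) := by simp
  have hhv : nbrs T (insert h (insert v A)) h = {v} := by
    ext y
    rw [mem_nbrs, Finset.mem_singleton]
    constructor
    · rintro ⟨hy, hhy⟩
      by_contra hyv
      have hyA : y ∈ A := by
        rcases Finset.mem_insert.1 hy with rfl | hy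
        · exact absurd rfl hhy.ne
        · exact Finset.mem_of_mem_insert_of_ne hy hyv
      exact hhA (hA.closed y hyA h hhU hvh.ne.symm hhy.symm)
    · rintro rfl
      exact ⟨hvW, hvh.symm⟩
  -- In the piece cut off, `h` is a leaf like `x`; these two take the leaf positions 0 and 2.
  have := niceNum_of_degree_four (y := ![x, a, h, c]) hT (hB.conn_insert hU hhU) hvW
    (injective_four hxa (hch x (by simp)) hxc (hch a (by simp)) hac (hch c (by simp)).symm) (by
      rw [image_four]
      ext y
      rw [mem_nbrs]
      constructor
      · rintro ⟨hy, hvy⟩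
        have hy' : y ∈ nbrs T U v := mem_nbrs.2 ⟨hWU hy, hvy⟩
        rw [hnb] at hy'
        simp only [Finset.mem_insert, Finset.mem_singleton] at hy'
        rcases hy' with rfl | rfl | rfl | rfl <;> simp
      · intro hy
        have hy' : y = h ∨ y ∈ ({x, a, c} : Finset V) := by
          simp only [Finset.mem_insert, Finset.mem_singleton] at hy ⊢
          rcases hy with rfl | rfl | rfl | rfl <;> simp
        rcases hy' with rfl | hy'
        · exact ⟨Finset.mem_insert_self _ _, hvh⟩
        · exact ⟨Finset.mem_insert_of_mem (Finset.mem_insert_of_mem (subset_branches hs hy')),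
            (mem_nbrs.1 (hs hy')).2⟩) (by
      apply Finset.Subset.antisymm
      · exact (nbrs_mono hWU).trans hx.subset
      · rw [Finset.singleton_subset_iff, mem_nbrs]
        exact ⟨hvW, (mem_nbrs.1 (hs (by simp))).2.symm⟩) hhv (by
      intro y hy hyv
      rcases Finset.mem_insert.1 hy with rfl | hy
      · simp [hhv]
      · exact (Finset.card_le_card (nbrs_mono hWU)).trans
          (hdeg y (Finset.mem_of_mem_insert_of_ne hy hyv)))
  rwa [hcB] at this

/-- Remove a fork. -/
theorem bounded_of_fork (hT : T.IsAcyclic) (hh : h ∈ nbrs T U v)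
    (hC : (nbrs T U v).erase h = {x, a, c})
    (hU : Conn T U) (hv : v ∈ U) (hxa : x ≠ a) (hxc : x ≠ c) (hac : a ≠ c)
    (ha : nbrs T U a ≠ {v}) (hcard : (branches T U v {x, a, c}).card ≤ 4)
    (ih : Bounded T (U \ branches T U v {x, a, c})) : Bounded T U := by
  have hA := branching_branches (T := T) (U := U) (v := v) (s := {x, a, c})
  have hs : ({x, a, c} : Finset V) ⊆ nbrs T U v := hC ▸ Finset.erase_subset _ _
  have hhA := not_mem_branches_erase hT hh hC
  obtain ⟨hhU, hvh⟩ := mem_nbrs.1 hh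
  obtain ⟨d, hd, had⟩ := exists_of_not_leaf hv (hs (by simp)) ha
  have hda := fun b (hb : T.Adj v b) (hba : b ≠ a) (hbd : b = d) =>
    hba (eq_of_mem_branch hT (mem_nbrs.1 (hs (by simp : a ∈ _))).2 hb (hbd ▸ hd))
  have hadj : ∀ b ∈ ({x, a, c} : Finset V), T.Adj v b := fun b hb => (mem_nbrs.1 (hs hb)).2
  have hvx := hadj x (by simp)
  have hva := hadj a (by simp)
  have hvc := hadj c (by simp)
  have hxd : x ≠ d := hda x hvx hxa
  have hcd : c ≠ d := hda c hvc hac.symm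
  have hsA := subset_branches hs
  have hdA : d ∈ branches T U v {x, a, c} := mem_branches.2 ⟨a, by simp, hd⟩
  set A := branches T U v {x, a, c} with hAdef
  have hxA : x ∈ A := hsA (by simp)
  have haA : a ∈ A := hsA (by simp)
  have hcA : c ∈ A := hsA (by simp)
  have hAeq : {x, c, a, d} = A := by
    apply Finset.eq_of_subset_of_card_le
    · simp [Finset.insert_subset_iff, hxA, haA, hcA, hdA]
    · rwa [Finset.card_insert_of_notMem (by simp [hxa, hxc, hxd]),
        Finset.card_insert_of_notMem (by simp [hac.symm, hcd]), Finset.card_pair had.ne]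
  have hnm : ∀ y ∈ A, y ∉ U \ A := fun y hy h => (Finset.mem_sdiff.1 h).2 hy
  have hvH : v ∈ U \ A := Finset.mem_sdiff.2 ⟨hv, hA.not_mem⟩
  have hH := hA.conn_compl hU hv
  obtain ⟨n, hn, hcov⟩ := ih
  have hAc : A.card = 4 := by
    rw [← hAeq, Finset.card_insert_of_notMem (by simp [hxa, hxc, hxd]),
        Finset.card_insert_of_notMem (by simp [hac.symm, hcd]), Finset.card_pair had.ne]
  have hUc := Finset.card_sdiff_add_card_eq_card hA.sub
  -- Five paths for four vertices: 15 ≤ 16.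
  refine ⟨n + 5, by omega, ?_⟩
  have h1 := edgesIn_insert hT hH hvH (hnm x hxA) hvx
  have hH1 := hH.insert hvH hvx
  have h2 := edgesIn_insert hT hH1 (by simp [hvH]) (a := c) (by
    rw [Finset.mem_insert, not_or]
    exact ⟨hxc.symm, hnm c hcA⟩) hvc
  have hH2 := hH1.insert (Finset.mem_insert_of_mem hvH) hvc
  have h3 := edgesIn_insert hT hH2 (Finset.mem_insert_of_mem (Finset.mem_insert_of_mem hvH))
    (a := a) (by
    rw [Finset.mem_insert, Finset.mem_insert, not_or, not_or]
    exact ⟨hac, hxa.symm, hnm a haA⟩) hva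
  have hH3 := hH2.insert (Finset.mem_insert_of_mem (Finset.mem_insert_of_mem hvH)) hva
  have h4 := edgesIn_insert hT hH3 (Finset.mem_insert_self _ _) (a := d) (by
    rw [Finset.mem_insert, Finset.mem_insert, Finset.mem_insert, not_or, not_or, not_or]
    exact ⟨had.ne.symm, hcd.symm, hxd.symm, hnm d hdA⟩) had
  have hUeq : insert d (insert a (insert c (insert x (U \ A)))) = U := by
    ext y
    rw [← Finset.sdiff_union_of_subset hA.sub, Finset.mem_union]
    nth_rw 3 [← hAeq]
    simp only [Finset.mem_insert]
    grind
  have hE : edgesIn T U = edgesIn T (U \ A) ∪ Set.range (forkEdge v x c a d) := by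
    have hr : Set.range (forkEdge v x c a d) = {s(v, x), s(v, c), s(v, a), s(a, d)} := by
      simp only [forkEdge, Matrix.range_cons, Matrix.range_empty, Set.union_empty]
      rfl
    rw [hr, ← hUeq, h4, h3, h2, h1, hUeq, insert_four]
  rw [hE]
  refine hcov.fork hvH (Finset.mem_sdiff.2 ⟨hhU, hhA⟩) hvh ?_ hvx hvc hva had (hnm x hxA)
    (hnm c hcA) (hnm a haA) (hnm d hdA) hxc hxa hac.symm hxd
  intro w hw hwv
  by_contra hwh
  apply (Finset.mem_sdiff.1 hw).2
  apply hsA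
  rw [← hC]
  exact Finset.mem_erase.2 ⟨hwh, mem_nbrs.2 ⟨(Finset.mem_sdiff.1 hw).1, hwv.symm⟩⟩

end last

end

/-! ### The induction -/

section

variable {V : Type u} {T : SimpleGraph V} [DecidableEq V] {U : Finset V} {v h : V}

theorem bounded_of_card_nbrs_le_three (hT : T.IsAcyclic) (hU : Conn T U) (hne : U.Nonempty)
    (hdeg : ∀ x ∈ U, (nbrs T U x).card ≤ 3) : Bounded T U := by
  -- Seven is the threshold for 3(|U| + 1) + 4 ≤ 4|U|.
  by_cases hc : 7 ≤ U.card
  · exact ⟨U.card + 1, by omega,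
      (niceNum_of_card_nbrs_le_three hT hU (by omega) hdeg).coverNum⟩
  by_cases h3 : ∃ v ∈ U, (nbrs T U v).card = 3
  · obtain ⟨v, hv, hd⟩ := h3
    exact bounded_of_degree_three hT hU hv hd (by omega)
  · push Not at h3
    exact coverNum_of_card_nbrs_le_two hT hU hne
      (fun x hx => by have := hdeg x hx; have := h3 x hx; omega) (by omega)

theorem exists_injective_three {V : Type*} {s : Finset V} (hs : 3 ≤ s.card) :
    ∃ y : Fin 3 → V, Function.Injective y ∧ ∀ i, y i ∈ s := by
  obtain ⟨t, hts, ht⟩ := Finset.exists_subset_card_eq hs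
  refine ⟨fun i => (t.equivFinOfCardEq ht).symm i, ?_, fun i => hts (Subtype.prop _)⟩
  exact Subtype.val_injective.comp (Equiv.injective _)

/-- The reduction at a vertex with at most two leaves all of whose branches but one have maximum
degree three. -/
theorem bounded_of_extremal (hT : T.IsAcyclic) (hU : Conn T U) (hv : v ∈ U)
    (hd : 4 ≤ (nbrs T U v).card) (hh : h ∈ nbrs T U v)
    (hdeg : ∀ x ∈ U, x ≠ v → x ∉ branch T U v h → (nbrs T U x).card ≤ 3)
    (hleaf : ((nbrs T U v).filter (nbrs T U · = {v})).card ≤ 2)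
    (ih : ∀ w A, w ∈ U → Branching T U w A → A.Nonempty → Bounded T (U \ A)) :
    Bounded T U := by
  set C := (nbrs T U v).erase h with hC
  have hCn : C ⊆ nbrs T U v := Finset.erase_subset _ _
  have hCc : 3 ≤ C.card := by
    rw [hC, Finset.card_erase_of_mem hh]
    omega
  have hdeg' : ∀ s ⊆ C, ∀ x ∈ branches T U v s, (nbrs T U x).card ≤ 3 := by
    intro s hs x hx
    obtain ⟨c, hc, hxc⟩ := mem_branches.1 hx
    have hc' := Finset.mem_erase.1 (hs hc)
    refine hdeg x (branching_branch.sub hxc) ?_ ?_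
    · rintro rfl
      exact branching_branch.not_mem hxc
    · exact Finset.disjoint_left.1
        (disjoint_branch hT (mem_nbrs.1 hc'.2).2 (mem_nbrs.1 hh).2 hc'.1) hxc
  have ih' : ∀ s ⊆ C, s.Nonempty → Bounded T (U \ branches T U v s) := fun s hs hne =>
    ih v _ hv branching_branches (hne.mono (subset_branches (hs.trans hCn)))
  set Lf := C.filter (nbrs T U · = {v}) with hLf
  set Nl := C.filter (nbrs T U · ≠ {v}) with hNl
  have hLc : Lf.card ≤ 2 :=
    (Finset.card_le_card (Finset.filter_subset_filter _ hCn)).trans hleaf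
  have hsum : Lf.card + Nl.card = C.card := Finset.card_filter_add_card_filter_not _
  have hLm : ∀ {x}, x ∈ Lf → x ∈ C ∧ nbrs T U x = {v} := fun hx => Finset.mem_filter.1 hx
  have hNm : ∀ {x}, x ∈ Nl → x ∈ C ∧ nbrs T U x ≠ {v} := fun hx => Finset.mem_filter.1 hx
  by_cases hN3 : 3 ≤ Nl.card
  · obtain ⟨s, hs, hsc⟩ := Finset.exists_subset_card_eq hN3
    have hsC : s ⊆ C := fun x hx => (hNm (hs hx)).1
    exact bounded_of_three_branches hT hU hv (hsC.trans hCn) hsc (fun c hc => (hNm (hs hc)).2)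
      (hdeg' s hsC) (ih' s hsC (Finset.card_pos.1 (by omega)))
  -- At most two leaves and at most two non-leaves remain in `C`, so four elements mean exactly two
  -- of each, and three elements include at least one of each.
  by_cases hC4 : 4 ≤ C.card
  · obtain ⟨x, b, hxb, hL⟩ := Finset.card_eq_two.1 (show Lf.card = 2 by omega)
    obtain ⟨a, c, hac, hN⟩ := Finset.card_eq_two.1 (show Nl.card = 2 by omega)
    have hx := hLm (x := x) (by simp [hL])
    have hb := hLm (x := b) (by simp [hL])
    have ha := hNm (x := a) (by simp [hN])
    have hc := hNm (x := c) (by simp [hN])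
    have hne : ∀ {y z}, nbrs T U y = {v} → nbrs T U z ≠ {v} → y ≠ z := by
      rintro y _ h1 h2 rfl
      exact h2 h1
    have hs : Finset.univ.image ![x, a, b, c] ⊆ C := by
      rw [image_four]
      simp [Finset.insert_subset_iff, hx.1, hb.1, ha.1, hc.1]
    exact bounded_of_four_branches hT hU hv
      (injective_four (hne hx.2 ha.2) hxb (hne hx.2 hc.2) (hne hb.2 ha.2).symm hac
        (hne hb.2 hc.2)) (hs.trans hCn) hx.2 ha.2 hb.2 hc.2 (hdeg' _ hs)
      (ih' _ hs ⟨x, by simp [image_four]⟩)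
  · have hC3 : C.card = 3 := by omega
    obtain ⟨x, hx⟩ := Finset.card_pos.1 (show 0 < Lf.card by omega)
    obtain ⟨a, ha⟩ := Finset.card_pos.1 (show 0 < Nl.card by omega)
    obtain ⟨hxC, hx⟩ := hLm hx
    obtain ⟨haC, ha⟩ := hNm ha
    have hxa : x ≠ a := fun h => ha (h ▸ hx)
    have haC' : a ∈ C.erase x := Finset.mem_erase.2 ⟨hxa.symm, haC⟩
    have h1 : ((C.erase x).erase a).card = 1 := by
      rw [Finset.card_erase_of_mem haC', Finset.card_erase_of_mem hxC, hC3]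
    obtain ⟨c, hc⟩ := Finset.card_eq_one.1 h1
    have hcC : c ≠ a ∧ c ≠ x ∧ c ∈ C := by
      have := Finset.mem_singleton_self c
      simpa only [← hc, Finset.mem_erase] using this
    have hCe : (nbrs T U v).erase h = {x, a, c} := by
      rw [← hC, ← Finset.insert_erase hxC, ← Finset.insert_erase haC', hc]
    rcases Nat.lt_or_ge 4 (branches T U v {x, a, c}).card with h5 | h5
    · refine bounded_of_cut hT hh hCe hU hv hxa hcC.2.1.symm hcC.1.symm hx h5
        (hdeg' _ hCe.symm.subset) (ih h _ (mem_nbrs.1 hh).1 ?_ (Finset.insert_nonempty _ _))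
      exact branching_insert_branches hT hh hCe hv
    · exact bounded_of_fork hT hh hCe hU hv hxa hcC.2.1.symm hcC.1.symm ha h5
        (ih' _ hCe.symm.subset (Finset.insert_nonempty _ _))

theorem bounded_of_conn (hT : T.IsAcyclic) (hU : Conn T U) (hne : U.Nonempty) : Bounded T U := by
  induction U using Finset.strongInduction with | _ U IH
  have ih : ∀ w A, w ∈ U → Branching T U w A → A.Nonempty → Bounded T (U \ A) :=
    fun w A hw hA hne => IH _ (Finset.sdiff_ssubset hA.sub hne) (hA.conn_compl hU hw)
      ⟨w, Finset.mem_sdiff.2 ⟨hw, hA.not_mem⟩⟩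
  by_cases hbig : ∃ v ∈ U, 4 ≤ (nbrs T U v).card
  swap
  · push Not at hbig
    exact bounded_of_card_nbrs_le_three hT hU hne fun x hx => Nat.le_of_lt_succ (hbig x hx)
  obtain ⟨v, hv, hd, h, hh, hdeg⟩ := exists_extremal hU hbig
  by_cases hleaf : ((nbrs T U v).filter (nbrs T U · = {v})).card ≤ 2
  · exact bounded_of_extremal hT hU hv hd hh hdeg hleaf ih
  · obtain ⟨y, hy, hyL⟩ := exists_injective_three (Nat.lt_of_not_le hleaf)
    have hyn := fun i => (Finset.mem_filter.1 (hyL i)).1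
    have hyl := fun i => (Finset.mem_filter.1 (hyL i)).2
    exact bounded_of_three_leaves hT hv hy hyn hyl
      (ih v _ hv (branching_of_leaves hyn hyl) ⟨y 0, by simp⟩)

end

/-! ### From systems to rainbow separating path systems -/

section

variable {V : Type u} {T : SimpleGraph V}

/-- A system for all edges of `T` is a rainbow separating path system. -/
theorem System.exists_isRainbowSeparating (S : System T T.edgeSet) :
    ∃ P : Multiset T.Subgraph, T.IsRainbowSeparating 2 P ∧ P.card = S.size := by
  have hp : ∀ i, ∃ H : T.Subgraph, H.IsPathOf ∧ S.path i = H.edgeSet := by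
    intro i
    obtain ⟨u, v, p, hp, he⟩ := S.isTrace i
    refine ⟨p.toSubgraph, ⟨u, v, p, hp, rfl⟩, ?_⟩
    rw [he]
    ext e
    exact p.mem_edges_toSubgraph.symm
  choose H hH hE using hp
  let := S.fin
  let q : S.ι → T.Subgraph × Fin 2 := fun i => (H i, if S.color i then 1 else 0)
  refine ⟨(Finset.univ.val.map q).map Prod.fst, ⟨?_, _, rfl, ?_⟩, ?_⟩
  · intro K hK
    simp only [Multiset.map_map, Multiset.mem_map] at hK
    obtain ⟨i, -, rfl⟩ := hK
    exact hH i
  · intro e he f hf hef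
    obtain ⟨i, j, hc, hi, hj⟩ := S.sep e he f hf hef
    refine ⟨q i, Multiset.mem_map_of_mem q (Finset.mem_univ i), q j,
      Multiset.mem_map_of_mem q (Finset.mem_univ j), ?_, ?_⟩
    · simp only [q]
      revert hc
      cases S.color i <;> cases S.color j <;> simp
    · simp only [q, ← hE]
      exact ⟨hi, hj⟩
  · rw [Multiset.card_map, Multiset.card_map]
    rfl

theorem edgesIn_univ [Fintype V] : edgesIn T Finset.univ = T.edgeSet := by
  ext e
  induction e with | _ x y
  simp

theorem conn_univ [Fintype V] (hT : T.Connected) : Conn T Finset.univ := fun x _ y _ => by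
  obtain ⟨p⟩ := hT.preconnected x y
  exact ⟨p, fun z _ => Finset.mem_univ z⟩

end

end RainbowTree

open RainbowTree in
theorem mainTheorem8 {V : Type*} [Fintype V] (T : SimpleGraph V) (hT : T.IsTree)
    (hn : 2 ≤ Fintype.card V) :
    ∃ c : ℕ, T.rainbowSeparationNumber 2 = (c : ℕ∞) ∧
      (c : ℝ) ≤ 4 * ((Fintype.card V : ℝ) - 1) / 3 := by
  classical
  obtain ⟨n, hb, hS⟩ := bounded_of_conn hT.2 (conn_univ hT.1)
    (Finset.card_pos.1 (by rw [Finset.card_univ]; omega))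
  rw [edgesIn_univ] at hS
  obtain ⟨S, rfl, -⟩ := hS
  obtain ⟨P, hP, hc⟩ := S.exists_isRainbowSeparating
  have hle : T.rainbowSeparationNumber 2 ≤ (S.size : ℕ∞) := hc ▸ iInf₂_le P hP
  obtain ⟨c, hc'⟩ := ENat.ne_top_iff_exists.1 (ne_top_of_le_ne_top (ENat.natCast_ne_top _) hle)
  refine ⟨c, hc'.symm, ?_⟩
  rw [← hc', Nat.cast_le] at hle
  rw [Finset.card_univ] at hb
  have h4 : (3 * c + 4 : ℝ) ≤ 4 * Fintype.card V := by exact_mod_cast (by omega)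
  linarith
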